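/- Notation. All spaces are real; $c_0$ carries the sup norm, $\mathbb N=\{1,2,\dots\}$, $B_E$ and $S_E$ are the closed unit ball and unit sphere of $E$, and $\mathrm{NA}(E,\mathbb R)=\{f\in E^*:\exists x\in S_E,\ |f(x)|=\|f\|\}$. A normed space $E$ is *smooth* if every $x\in S_E$ admits exactly one $f\in S_{E^*}$ with $f(x)=1$. An *operator range* in a Banach space is the image of an infinite-dimensional Banach space under a bounded injective linear operator. Consider the following choices. 1. An equivalent smooth norm $|||\cdot|||$ on $X=c_0$ with $\mathrm{NA}((X,|||\cdot|||),\mathbb R)=\mathrm{NA}(c_0,\mathbb R)$. 2. A separable operator range $Y$, dense in $(X,|||\cdot|||)^*$, with $\mathrm{NA}((X,|||\cdot|||),\mathbb R)\cap Y=\{0\}$. 3. An injective operator $T:\ell_1(\mathbb N\times\mathbb N)\to (X,|||\cdot|||)^*$ with $\|T\|=1$ and values in $Y$ such that, writing $v^*_{n,m}=T(e_{n,m})$, for every $m\in\mathbb N$ the set $\{v^*_{n,m}/|||v^*_{n,m}|||:n\in\mathbb N\}$ is dense in $S_Y$ (where $Y$ carries the norm of $(X,|||\cdot|||)^*$). Given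 such choices, for $m\in\mathbb N$ put $\Phi_m(n)=2^{-m}2^{-n}|||v^*_{n,m}|||$, let $S_{\Phi_m}:\ell_2\to\ell_1$ be $[S_{\Phi_m}(a)](n)=\Phi_m(n)a(n)$, and let $|\cdot|_m$ be the equivalent norm on $\ell_1$ whose closed unit ball is $B_{\ell_1}+S_{\Phi_m}(B_{\ell_2})$. Define $R_m:X\to(\ell_1,|\cdot|_m)$ by $[R_m(x)](n)=\frac{m}{2^m}\frac1{2^n}v^*_{n,m}(x)$, let $W=\left[\bigoplus_{m}(\ell_1,|\cdot|_m)\right]_{\ell_1}$ and $R(x)=(R_m(x))_{m}\in W$, and let $$p(x)=|||x|||+\|R(x)\|_W=|||x|||+\sum_{m=1}^\infty|R_m(x)|_m\qquad(x\in X),$$ which is an equivalent norm on $X$. Put $\mathbb X=(X,p)$. **Proposition.** Choices as in 1–3 exist, and for all such choices the bidual $\mathbb X^{**}$ of $\mathbb X=(X,p)$ is strictly convex, $\mathbb X^*$ is smooth, and $\mathbb X$ is strictly convex. -/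

import Mathlib

open scoped ZeroAtInfty Pointwise

noncomputable section

/-! ### Equivalent renormings -/

/-- An equivalent norm on a real normed space `E`. -/
structure EquivNorm (E : Type) [NormedAddCommGroup E] [NormedSpace ℝ E] where
  /-- the new norm -/
  toSeminorm : Seminorm ℝ E
  lower : ∃ c : ℝ, 0 < c ∧ ∀ x, c * ‖x‖ ≤ toSeminorm x
  upper : ∃ C : ℝ, ∀ x, toSeminorm x ≤ C * ‖x‖

namespace EquivNorm

/-- The vector space `E` endowed with the equivalent norm `q`. -/
def Space {E : Type} [NormedAddCommGroup E] [NormedSpace ℝ E] (_q : EquivNorm E) : Type := E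

instance {E : Type} [NormedAddCommGroup E] [NormedSpace ℝ E] (q : EquivNorm E) :
    AddCommGroup q.Space := inferInstanceAs (AddCommGroup E)

instance {E : Type} [NormedAddCommGroup E] [NormedSpace ℝ E] (q : EquivNorm E) :
    Module ℝ q.Space := inferInstanceAs (Module ℝ E)

/-- The identity map from `E` to the renormed space. -/
def toLin {E : Type} [NormedAddCommGroup E] [NormedSpace ℝ E] (q : EquivNorm E) :
    E ≃ₗ[ℝ] q.Space := LinearEquiv.refl ℝ E

instance {E : Type} [NormedAddCommGroup E] [NormedSpace ℝ E] (q : EquivNorm E) :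
    Norm q.Space := ⟨fun x => q.toSeminorm (q.toLin.symm x)⟩

theorem norm_toLin {E : Type} [NormedAddCommGroup E] [NormedSpace ℝ E] (q : EquivNorm E) (x : E) :
    ‖q.toLin x‖ = q.toSeminorm x := rfl

theorem core {E : Type} [NormedAddCommGroup E] [NormedSpace ℝ E] (q : EquivNorm E) :
    NormedSpace.Core ℝ q.Space where
  norm_nonneg x := apply_nonneg q.toSeminorm _
  norm_smul c x := map_smul_eq_mul q.toSeminorm c (q.toLin.symm x)
  norm_triangle x y := map_add_le_add q.toSeminorm (q.toLin.symm x) (q.toLin.symm y)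
  norm_eq_zero_iff x := by
    constructor
    · intro h
      obtain ⟨c, hc, hl⟩ := q.lower
      have h1 := hl (q.toLin.symm x)
      have h2 : q.toSeminorm (q.toLin.symm x) = 0 := h
      have h3 : ‖q.toLin.symm x‖ = 0 := by
        have := norm_nonneg (q.toLin.symm x)
        nlinarith
      have h4 : q.toLin.symm x = 0 := norm_eq_zero.mp h3
      exact q.toLin.symm.map_eq_zero_iff.mp h4
    · rintro rfl
      exact map_zero q.toSeminorm

instance {E : Type} [NormedAddCommGroup E] [NormedSpace ℝ E] (q : EquivNorm E) :
    NormedAddCommGroup q.Space := NormedAddCommGroup.ofCore q.core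

instance {E : Type} [NormedAddCommGroup E] [NormedSpace ℝ E] (q : EquivNorm E) :
    NormedSpace ℝ q.Space := NormedSpace.ofCore q.core

/-- The identity map as a continuous linear map from `E` to the renormed space. -/
def toCLM {E : Type} [NormedAddCommGroup E] [NormedSpace ℝ E] (q : EquivNorm E) :
    E →L[ℝ] q.Space :=
  q.toLin.toLinearMap.mkContinuousOfExistsBound q.upper

end EquivNorm

/-! ### Notions from Banach space geometry -/

/-- `f ∈ NA(E, ℝ)`. -/
def IsNormAttaining {E : Type} [NormedAddCommGroup E] [NormedSpace ℝ E]
    (f : StrongDual ℝ E) : Prop :=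
  ∃ x : E, ‖x‖ = 1 ∧ |f x| = ‖f‖

/-- `E` is smooth: every point of the unit sphere has exactly one norm-one supporting functional. -/
def IsSmoothSpace (E : Type) [NormedAddCommGroup E] [NormedSpace ℝ E] : Prop :=
  ∀ x : E, ‖x‖ = 1 → ∃! f : StrongDual ℝ E, ‖f‖ = 1 ∧ f x = 1

/-- `Y` is an operator range: the image of an infinite-dimensional Banach space under a bounded
injective linear operator. -/
def IsOperatorRange {X : Type} [NormedAddCommGroup X] [NormedSpace ℝ X]
    (Y : Submodule ℝ X) : Prop :=
  ∃ (E : Type) (_ : NormedAddCommGroup E) (_ : NormedSpace ℝ E) (_ : CompleteSpace E)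
    (A : E →L[ℝ] X), ¬ FiniteDimensional ℝ E ∧ Function.Injective A ∧
      LinearMap.range A.toLinearMap = Y

/-! ### The smooth renormings of `ℓ₁` -/

/-- `ℓ₁`. -/
abbrev Ell1 : Type := lp (fun _ : ℕ => ℝ) 1

/-- `ℓ₂`. -/
abbrev Ell2 : Type := lp (fun _ : ℕ => ℝ) 2

theorem Ell1.norm_eq (x : Ell1) : ‖x‖ = ∑' n, ‖x n‖ := by
  simpa using lp.norm_eq_tsum_rpow (p := 1) (by simp) x

theorem memℓp_one_iff {E : ℕ → Type} [∀ n, NormedAddCommGroup (E n)] {f : ∀ n, E n} :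
    Memℓp f 1 ↔ Summable fun n => ‖f n‖ := by
  simpa using memℓp_gen_iff (p := 1) (f := f) (by simp)

theorem diag_bound (Φ : Ell1) (a : Ell2) (n : ℕ) : ‖Φ n * a n‖ ≤ ‖Φ n‖ * ‖a‖ := by
  rw [norm_mul]
  exact mul_le_mul_of_nonneg_left (lp.norm_apply_le_norm (by simp) a n) (norm_nonneg _)

theorem diag_summable (Φ : Ell1) (a : Ell2) : Summable fun n => ‖Φ n * a n‖ :=
  Summable.of_nonneg_of_le (fun _ => norm_nonneg _) (diag_bound Φ a)
    ((memℓp_one_iff.mp (lp.memℓp Φ)).mul_right _)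

/-- The operator `S_Φ : ℓ₂ → ℓ₁`, `[S_Φ a](n) = Φ(n) a(n)`. -/
def diagOp (Φ : Ell1) : Ell2 →L[ℝ] Ell1 :=
  LinearMap.mkContinuous
    { toFun := fun a => ⟨fun n => Φ n * a n, memℓp_one_iff.mpr (diag_summable Φ a)⟩
      map_add' := fun a b => by
        apply Subtype.ext
        funext n
        exact mul_add (Φ n) (a n) (b n)
      map_smul' := fun c a => by
        apply Subtype.ext
        funext n
        exact mul_left_comm (Φ n) c (a n) }
    ‖Φ‖ (fun a => by
      rw [Ell1.norm_eq, Ell1.norm_eq, ← tsum_mul_right]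
      exact Summable.tsum_le_tsum (diag_bound Φ a) (diag_summable Φ a)
        ((memℓp_one_iff.mp (lp.memℓp Φ)).mul_right _))

/-- The set `B_{ℓ₁} + S_Φ(B_{ℓ₂})`. -/
def phiBall (Φ : Ell1) : Set Ell1 :=
  Metric.closedBall (0 : Ell1) 1 + diagOp Φ '' Metric.closedBall (0 : Ell2) 1

theorem phiBall_convex (Φ : Ell1) : Convex ℝ (phiBall Φ) :=
  (convex_closedBall _ _).add ((convex_closedBall _ _).linear_image (diagOp Φ).toLinearMap)

theorem phiBall_neg (Φ : Ell1) : ∀ x ∈ phiBall Φ, -x ∈ phiBall Φ := by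
  rintro _ ⟨y, hy, _, ⟨a, ha, rfl⟩, rfl⟩
  refine ⟨-y, by simpa using hy, -(diagOp Φ a), ⟨-a, by simpa using ha, by simp⟩, ?_⟩
  simp [add_comm]

theorem closedBall_subset_phiBall (Φ : Ell1) : Metric.closedBall (0 : Ell1) 1 ⊆ phiBall Φ := by
  intro x hx
  exact ⟨x, hx, 0, ⟨0, by simp, by simp⟩, by simp⟩

theorem phiBall_subset_closedBall (Φ : Ell1) :
    phiBall Φ ⊆ Metric.closedBall (0 : Ell1) (1 + ‖diagOp Φ‖) := by
  rintro _ ⟨y, hy, _, ⟨a, ha, rfl⟩, rfl⟩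
  rw [mem_closedBall_zero_iff] at *
  refine (norm_add_le _ _).trans (add_le_add hy ?_)
  exact ((diagOp Φ).le_opNorm a).trans (mul_le_of_le_one_right (norm_nonneg _) ha)

theorem phiBall_absorbent (Φ : Ell1) : Absorbent ℝ (phiBall Φ) :=
  absorbent_nhds_zero
    (Filter.mem_of_superset (Metric.closedBall_mem_nhds _ one_pos) (closedBall_subset_phiBall Φ))

/-- The equivalent norm `|·|_Φ` on `ℓ₁` whose closed unit ball is `B_{ℓ₁} + S_Φ(B_{ℓ₂})`. -/
def phiNorm (Φ : Ell1) : EquivNorm Ell1 where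
  toSeminorm := gaugeSeminorm
    ((balanced_iff_neg_mem (phiBall_convex Φ)).mpr fun x hx => phiBall_neg Φ x hx)
    (phiBall_convex Φ) (phiBall_absorbent Φ)
  lower := by
    have h0 : 0 < 1 + ‖diagOp Φ‖ := by positivity
    refine ⟨(1 + ‖diagOp Φ‖)⁻¹, inv_pos.mpr h0, fun x => ?_⟩
    have h := le_gauge_of_subset_closedBall (phiBall_absorbent Φ) h0.le
      (phiBall_subset_closedBall Φ) (x := x)
    rw [inv_mul_eq_div]
    exact h
  upper := by
    refine ⟨1, fun x => ?_⟩
    have h := gauge_mono (absorbent_nhds_zero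
      (Metric.closedBall_mem_nhds (0 : Ell1) one_pos)) (closedBall_subset_phiBall Φ) x
    have h2 := gauge_closedBall (zero_le_one (α := ℝ)) x
    rw [h2] at h
    simpa using h

theorem phiNorm_le (Φ x : Ell1) : ‖(phiNorm Φ).toLin x‖ ≤ ‖x‖ := by
  change gauge (phiBall Φ) x ≤ ‖x‖
  have h := gauge_mono (absorbent_nhds_zero
    (Metric.closedBall_mem_nhds (0 : Ell1) one_pos)) (closedBall_subset_phiBall Φ) x
  have h2 := gauge_closedBall (zero_le_one (α := ℝ)) x
  rw [h2] at h
  simpa using h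

/-! ### The construction

The positive integers `n, m` of the usual description are written `n + 1, m + 1` with `n m : ℕ`. -/

/-- `ℓ₁(ℕ × ℕ)`. -/
abbrev Ell1Prod : Type := lp (fun _ : ℕ × ℕ => ℝ) 1

/-- The choices that enter the construction of the space `𝕏`:
* an equivalent smooth norm `q` on `c₀` with the same norm-attaining functionals as the sup norm;
* a dense separable operator range `Y` in `(c₀, q)*` which meets `NA((c₀, q), ℝ)` only in `0`;
* an injective norm-one operator `T : ℓ₁(ℕ × ℕ) → Y` such that, for every `m`, the normalized
  vectors `T e_{n,m} / q*(T e_{n,m})` are dense in the unit sphere of `Y`. -/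
structure Choices where
  q : EquivNorm C₀(ℕ, ℝ)
  smooth : IsSmoothSpace q.Space
  na_eq : ∀ f : StrongDual ℝ q.Space, IsNormAttaining f ↔ IsNormAttaining (f.comp q.toCLM)
  Y : Submodule ℝ (StrongDual ℝ q.Space)
  opRange : IsOperatorRange Y
  separable : TopologicalSpace.IsSeparable (Y : Set (StrongDual ℝ q.Space))
  dense : Dense (Y : Set (StrongDual ℝ q.Space))
  na_inter : {f : StrongDual ℝ q.Space | IsNormAttaining f} ∩ (Y : Set _) = {0}
  T : Ell1Prod →L[ℝ] StrongDual ℝ q.Space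
  T_mem : ∀ a, T a ∈ Y
  T_inj : Function.Injective T
  T_norm : ‖T‖ = 1
  T_dense : ∀ m : ℕ, {y : StrongDual ℝ q.Space | y ∈ Y ∧ ‖y‖ = 1} ⊆
    closure (Set.range fun n : ℕ => ‖T (lp.single 1 (n, m) 1)‖⁻¹ • T (lp.single 1 (n, m) 1))

namespace Choices

/-- The functionals `v*_{n,m} = T e_{n,m}`. -/
def v (D : Choices) (n m : ℕ) : StrongDual ℝ D.q.Space := D.T (lp.single 1 (n, m) 1)

theorem norm_v_le (D : Choices) (n m : ℕ) : ‖D.v n m‖ ≤ 1 := by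
  have h := D.T.le_opNorm (lp.single 1 (n, m) (1 : ℝ))
  rw [D.T_norm, lp.norm_single (by simp)] at h
  simpa [v] using h

theorem summable_geom : Summable fun n : ℕ => (1 / 2 ^ (n + 1) : ℝ) := by
  have h := (summable_nat_add_iff 1).mpr summable_geometric_two
  simpa using h

theorem summable_weight : Summable fun m : ℕ => ((m + 1 : ℝ) / 2 ^ (m + 1)) := by
  have h := (summable_nat_add_iff 1).mpr
    (summable_pow_mul_geometric_of_norm_lt_one (R := ℝ) 1 (r := 1 / 2) (by norm_num))
  refine h.congr fun m => ?_
  push_cast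
  rw [pow_one, one_div, inv_pow, div_eq_mul_inv]

theorem tsum_geom : ∑' n : ℕ, (1 / 2 ^ (n + 1) : ℝ) = 1 := by
  refine Eq.trans (tsum_congr fun n => ?_) (tsum_geometric_two' 1)
  rw [pow_succ, div_div, mul_comm]

/-- The sequence `Φ_m(n) = 2^{-m} 2^{-n} q*(v*_{n,m})`. -/
def Phi (D : Choices) (m : ℕ) : Ell1 :=
  ⟨fun n => 1 / 2 ^ (m + 1) * (1 / 2 ^ (n + 1)) * ‖D.v n m‖, memℓp_one_iff.mpr (by
    refine Summable.of_nonneg_of_le (fun _ => norm_nonneg _) (fun n => ?_)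
      (summable_geom.mul_left (1 / 2 ^ (m + 1)))
    rw [Real.norm_of_nonneg (by positivity)]
    exact mul_le_of_le_one_right (by positivity) (D.norm_v_le n m))⟩

/-- The space `(ℓ₁, |·|_m)`. -/
abbrev L (D : Choices) (m : ℕ) : Type := (phiNorm (D.Phi m)).Space

/-- The space `W`, the `ℓ₁`-sum of the spaces `(ℓ₁, |·|_m)`. -/
abbrev W (D : Choices) : Type := lp D.L 1

theorem Rcoord_bound (D : Choices) (m : ℕ) (x : D.q.Space) (n : ℕ) :
    ‖(m + 1 : ℝ) / 2 ^ (m + 1) * (1 / 2 ^ (n + 1)) * D.v n m x‖ ≤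
      (m + 1 : ℝ) / 2 ^ (m + 1) * ‖x‖ * (1 / 2 ^ (n + 1)) := by
  rw [norm_mul, Real.norm_of_nonneg (by positivity), mul_right_comm _ ‖x‖]
  refine mul_le_mul_of_nonneg_left ?_ (by positivity)
  exact ((D.v n m).le_opNorm x).trans (mul_le_of_le_one_left (norm_nonneg _) (D.norm_v_le n m))

theorem Rcoord_summable (D : Choices) (m : ℕ) (x : D.q.Space) :
    Summable fun n : ℕ => ‖(m + 1 : ℝ) / 2 ^ (m + 1) * (1 / 2 ^ (n + 1)) * D.v n m x‖ :=
  Summable.of_nonneg_of_le (fun _ => norm_nonneg _) (D.Rcoord_bound m x)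
    (summable_geom.mul_left _)

/-- The sequence `[R_m x](n) = (m / 2^m) 2^{-n} v*_{n,m}(x)`, as an element of `ℓ₁`. -/
def Rcoord (D : Choices) (m : ℕ) (x : D.q.Space) : Ell1 :=
  ⟨fun n => (m + 1 : ℝ) / 2 ^ (m + 1) * (1 / 2 ^ (n + 1)) * D.v n m x,
    memℓp_one_iff.mpr (D.Rcoord_summable m x)⟩

/-- The operator `R_m`, with `[R_m x](n) = (m / 2^m) 2^{-n} v*_{n,m}(x)`. -/
def Rm (D : Choices) (m : ℕ) : D.q.Space →ₗ[ℝ] D.L m where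
  toFun x := (phiNorm (D.Phi m)).toLin (D.Rcoord m x)
  map_add' x y := by
    rw [← map_add]
    congr 1
    apply Subtype.ext
    funext n
    change _ * D.v n m (x + y) = _ * D.v n m x + _ * D.v n m y
    rw [map_add, mul_add]
  map_smul' c x := by
    rw [RingHom.id_apply, ← map_smul]
    congr 1
    apply Subtype.ext
    funext n
    change _ * D.v n m (c • x) = c * (_ * D.v n m x)
    rw [map_smul, smul_eq_mul, mul_left_comm]

theorem norm_Rm_le (D : Choices) (m : ℕ) (x : D.q.Space) :
    ‖D.Rm m x‖ ≤ (m + 1 : ℝ) / 2 ^ (m + 1) * ‖x‖ := by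
  refine (phiNorm_le (D.Phi m) (D.Rcoord m x)).trans ?_
  rw [Ell1.norm_eq]
  refine (Summable.tsum_le_tsum (D.Rcoord_bound m x) (D.Rcoord_summable m x)
    (summable_geom.mul_left _)).trans ?_
  rw [tsum_mul_left, tsum_geom, mul_one]

theorem norm_Rm_summable (D : Choices) (x : D.q.Space) : Summable fun m => ‖D.Rm m x‖ :=
  Summable.of_nonneg_of_le (fun _ => norm_nonneg _) (fun m => D.norm_Rm_le m x)
    (summable_weight.mul_right _)

/-- The operator `R x = (R_m x)_m` into `W`. -/
def R (D : Choices) : D.q.Space →ₗ[ℝ] D.W where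
  toFun x := ⟨fun m => D.Rm m x, memℓp_one_iff.mpr (D.norm_Rm_summable x)⟩
  map_add' x y := by
    apply Subtype.ext
    funext m
    exact map_add (D.Rm m) x y
  map_smul' c x := by
    apply Subtype.ext
    funext m
    exact map_smul (D.Rm m) c x

theorem norm_R_le (D : Choices) (x : D.q.Space) :
    ‖D.R x‖ ≤ (∑' m : ℕ, (m + 1 : ℝ) / 2 ^ (m + 1)) * ‖x‖ := by
  have h : ‖D.R x‖ = ∑' m, ‖D.Rm m x‖ := by
    have h0 := lp.norm_eq_tsum_rpow (p := 1) (by simp) (D.R x)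
    simp only [ENNReal.toReal_one, Real.rpow_one, div_one] at h0
    exact h0
  rw [h, ← tsum_mul_right]
  exact Summable.tsum_le_tsum (fun m => D.norm_Rm_le m x) (D.norm_Rm_summable x)
    (summable_weight.mul_right _)

/-- The equivalent norm `p(x) = q(x) + ‖R x‖_W`. -/
def p (D : Choices) : EquivNorm D.q.Space where
  toSeminorm := normSeminorm ℝ D.q.Space + (normSeminorm ℝ D.W).comp D.R
  lower := ⟨1, one_pos, fun x => by
    change 1 * ‖x‖ ≤ ‖x‖ + ‖D.R x‖
    rw [one_mul]
    exact le_add_of_nonneg_right (norm_nonneg _)⟩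
  upper := ⟨1 + ∑' m : ℕ, (m + 1 : ℝ) / 2 ^ (m + 1), fun x => by
    change ‖x‖ + ‖D.R x‖ ≤ _
    rw [add_mul, one_mul]
    exact add_le_add le_rfl (D.norm_R_le x)⟩

/-- The space `𝕏 = (c₀, p)`. -/
abbrev X (D : Choices) : Type := D.p.Space

end Choices

end

open scoped ZeroAtInfty Pointwise

noncomputable section

/-! ### Strict convexity and smoothness under duality -/

/-! Strict convexity of the bidual gives the other two properties by duality, and it already follows
from the single summand `|R_0 x|_0` of the norm. Suppose `‖x + y‖ = ‖x‖ + ‖y‖` in the bidual.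
Writing the norm as `N(x) + ‖A x‖` with `A = R_0`, a Hahn–Banach splitting of almost norming
functionals shows that the bitranspose of `A` preserves this equality (`norm_bitranspose_add_eq`).
The weights in `R_0` are summable, so this bitranspose still takes values in `ℓ₁`. The norm with
ball `B_{ℓ₁} + S_Φ(B_{ℓ₂})` is strictly monotone in each coordinate, so equality in its triangle
inequality forbids opposite signs in any coordinate (`mul_nonneg_of_norm_add_eq`). Hence `x(v) y(v)
≥ 0` for all `v = v*_{n,0}`. Their directions are dense, so the inequality holds on the whole dual,
and this makes `x` and `y` positively proportional (`sameRay_of_mul_nonneg`).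

For existence, renorm `c₀` by the ball `B_{c₀} + S(B_{ℓ₂})` with `S` compact of dense range. The
dual norm is `‖f‖ + ‖S* f‖`, which is strictly convex, and norm attainment is unchanged because
functionals on `ℓ₂` always attain their norm. Norm-attaining functionals on `c₀` have finite
support. The matrix `2^{-(n+1)(k+1)}` evaluates power series at points tending to `0`, so its range
contains no nonzero finitely supported sequence; by symmetry of the matrix that range is also dense.
Finally, `T` sends the unit vectors to rapidly decreasing multiples of truncated dense directions,
each perturbed by a new coordinate: the perturbations vanish in the limit, yet a triangular estimate
makes `T` injective. -/

theorem isSmoothSpace_of_strictConvexSpace_dual (E : Type) [NormedAddCommGroup E]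
    [NormedSpace ℝ E] [StrictConvexSpace ℝ (StrongDual ℝ E)] : IsSmoothSpace E := by
  intro x hx
  obtain ⟨f, hf, hfx⟩ := exists_dual_vector ℝ x (by simp [hx])
  have hfx1 : f x = 1 := by rw [hfx, hx]; rfl
  refine ⟨f, ⟨hf, hfx1⟩, fun g hg => ?_⟩
  -- Two supporting functionals at `x` add up to a functional with value `2` at `x`, so their sum
  -- has norm `2`.
  refine eq_of_norm_eq_of_norm_add_eq (hg.1.trans hf.symm) (le_antisymm (norm_add_le _ _) ?_)
  have h := (g + f).le_opNorm x
  rw [add_apply, hg.2, hfx1, hx, mul_one] at h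
  rw [hg.1, hf]
  exact (le_abs_self _).trans h

theorem strictConvexSpace_of_linearIsometry {E F : Type} [NormedAddCommGroup E] [NormedSpace ℝ E]
    [NormedAddCommGroup F] [NormedSpace ℝ F] [StrictConvexSpace ℝ F] (i : E →ₗᵢ[ℝ] F) :
    StrictConvexSpace ℝ E := by
  refine StrictConvexSpace.of_norm_add fun x y hx hy hxy => ?_
  rw [← i.injective.sameRay_map_iff (f := i.toLinearMap), sameRay_iff_norm_add]
  change ‖i x + i y‖ = ‖i x‖ + ‖i y‖
  rw [← map_add, i.norm_map, i.norm_map, i.norm_map, hx, hy, hxy]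
  norm_num

theorem strictConvexSpace_of_bidual (E : Type) [NormedAddCommGroup E] [NormedSpace ℝ E]
    [StrictConvexSpace ℝ (StrongDual ℝ (StrongDual ℝ E))] : StrictConvexSpace ℝ E :=
  strictConvexSpace_of_linearIsometry (F := StrongDual ℝ (StrongDual ℝ E))
    (NormedSpace.inclusionInDoubleDualLi ℝ)

/-- The Riesz isometry transfers strict convexity from the Hilbert space `ℓ₂`. -/
instance strictConvexSpace_dual_ell2 : StrictConvexSpace ℝ (StrongDual ℝ Ell2) := by
  refine StrictConvexSpace.of_norm_add fun x y hx hy hxy => ?_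
  set e := (InnerProductSpace.toDual ℝ Ell2).symm
  have h : e x = e y := by
    refine eq_of_norm_eq_of_norm_add_eq ?_ ?_
    · rw [e.norm_map, e.norm_map, hx, hy]
    · rw [← map_add, e.norm_map, e.norm_map, e.norm_map, hx, hy, hxy]; norm_num
  exact e.injective h ▸ SameRay.rfl

/-- Two nonzero functionals whose product is nonnegative everywhere are positively proportional. -/
theorem sameRay_of_mul_nonneg {V : Type} [NormedAddCommGroup V] [NormedSpace ℝ V]
    (x y : StrongDual ℝ V) (h : ∀ f, 0 ≤ x f * y f) : SameRay ℝ x y := by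
  by_cases hx : x = 0
  · rw [hx]; exact SameRay.zero_left y
  obtain ⟨f₁, hf₁⟩ : ∃ f, x f ≠ 0 := by
    by_contra! hc
    exact hx (ContinuousLinearMap.ext hc)
  set f₀ := (x f₁)⁻¹ • f₁ with hf₀
  have hx1 : x f₀ = 1 := by simp [hf₀, hf₁]
  set c := y f₀ with hc
  have hc0 : 0 ≤ c := by simpa [hx1, ← hc] using h f₀
  have key : y = c • x := by
    ext f
    have hs : ∀ s : ℝ, 0 ≤ (x f + s) * (y f + s * c) := fun s => by
      simpa [hx1, ← hc] using h (f + s • f₀)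
    -- Shifting `s` by `x f` exposes the linear coefficient `d = y f - c x f`; near `t = 0` it
    -- dominates, so it must vanish.
    have hd : ∀ t : ℝ, 0 ≤ t * ((y f - c * x f) + t * c) := fun t => by
      have := hs (t - x f)
      ring_nf at this ⊢
      linarith
    set d := y f - c * x f with hdd
    have hd0 : d = 0 := by
      -- With `c + 1` in place of `c` the test value also makes sense for `c = 0`.
      have h1 := hd (-d / (2 * (c + 1)))
      have h2 : -d / (2 * (c + 1)) * (d + -d / (2 * (c + 1)) * c)
          = -(d ^ 2 * ((c + 2) / (4 * (c + 1) ^ 2))) := by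
        field_simp
        ring
      rw [h2] at h1
      have h3 : 0 < (c + 2) / (4 * (c + 1) ^ 2) := by positivity
      have h4 : d ^ 2 ≤ 0 := by nlinarith [sq_nonneg d]
      exact pow_eq_zero_iff (two_ne_zero) |>.mp (le_antisymm h4 (sq_nonneg d))
    simp only [smul_apply, smul_eq_mul]
    linarith
  rw [key]
  exact SameRay.sameRay_nonneg_smul_right x hc0

/-! ### Operators on `ℓ₁` -/

section Lift

variable {ι E : Type} [NormedAddCommGroup E] [NormedSpace ℝ E]

theorem memℓp_one_iff_summable {f : ι → ℝ} : Memℓp f 1 ↔ Summable fun n => ‖f n‖ := by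
  simpa using memℓp_gen_iff (p := 1) (f := f) (by simp)

theorem norm_ell1_eq (x : lp (fun _ : ι => ℝ) 1) : ‖x‖ = ∑' n, ‖x n‖ := by
  simpa using lp.norm_eq_tsum_rpow (p := 1) (by simp) x

variable [CompleteSpace E]

theorem summable_smul_of_bounded {u : ι → E} {C : ℝ} (hu : ∀ i, ‖u i‖ ≤ C)
    (a : lp (fun _ : ι => ℝ) 1) : Summable fun i => a i • u i :=
  Summable.of_norm_bounded ((memℓp_one_iff_summable.mp (lp.memℓp a)).mul_right C) fun i => by
    rw [norm_smul]
    exact mul_le_mul_of_nonneg_left (hu i) (norm_nonneg _)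

/-- The operator on `ℓ₁(ι)` mapping the unit vectors to a given bounded family. -/
def ell1Lift [Nonempty ι] (u : ι → E) (hu : ∃ C, ∀ i, ‖u i‖ ≤ C) :
    lp (fun _ : ι => ℝ) 1 →L[ℝ] E :=
  LinearMap.mkContinuousOfExistsBound
    { toFun := fun a => ∑' i, a i • u i
      map_add' := fun a b => by
        obtain ⟨C, hC⟩ := hu
        rw [← (summable_smul_of_bounded hC a).tsum_add (summable_smul_of_bounded hC b)]
        exact tsum_congr fun i => add_smul (a i) (b i) (u i)
      map_smul' := fun c a => by
        obtain ⟨C, hC⟩ := hu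
        rw [RingHom.id_apply, ← (summable_smul_of_bounded hC a).tsum_const_smul]
        exact tsum_congr fun i => mul_smul c (a i) (u i) }
    (by
      obtain ⟨C, hC⟩ := hu
      refine ⟨C, fun a => ?_⟩
      have hs := memℓp_one_iff_summable.mp (lp.memℓp a)
      refine tsum_of_norm_bounded (g := fun i => C * ‖a i‖) ?_ fun i => ?_
      · rw [norm_ell1_eq]
        exact hs.hasSum.mul_left C
      · rw [norm_smul, mul_comm]
        exact mul_le_mul_of_nonneg_right (hC i) (norm_nonneg _))

theorem hasSum_ell1Lift [Nonempty ι] (u : ι → E) (hu : ∃ C, ∀ i, ‖u i‖ ≤ C)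
    (a : lp (fun _ : ι => ℝ) 1) : HasSum (fun i => a i • u i) (ell1Lift u hu a) := by
  obtain ⟨C, hC⟩ := hu
  exact (summable_smul_of_bounded hC a).hasSum

theorem ell1Lift_single [Nonempty ι] [DecidableEq ι] (u : ι → E) (hu : ∃ C, ∀ i, ‖u i‖ ≤ C)
    (i : ι) : ell1Lift u hu (lp.single 1 i 1) = u i := by
  refine (hasSum_ell1Lift u hu _).unique ?_
  convert hasSum_single (f := fun j => (lp.single (E := fun _ : ι => ℝ) 1 i 1) j • u j) i ?_ using 1
  · simp
  · intro j hj
    rw [lp.single_apply_ne _ _ _ hj, zero_smul]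

end Lift

/-- Supplies the dense sequence from which the directions of `T` are built. -/
instance separableSpace_ell1 : TopologicalSpace.SeparableSpace Ell1 := by
  have h1 : TopologicalSpace.IsSeparable
      (Set.range fun n : ℕ => (lp.single 1 n (1 : ℝ) : Ell1)) :=
    (Set.countable_range _).isSeparable
  have h2 := (h1.span (R := ℝ)).closure
  rw [← TopologicalSpace.isSeparable_univ_iff]
  refine h2.mono fun a _ => ?_
  have h3 := lp.hasSum_single (E := fun _ : ℕ => ℝ) (p := 1) (by simp) a
  refine mem_closure_of_tendsto h3 (Filter.Eventually.of_forall fun s => ?_)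
  refine Submodule.sum_mem _ fun i _ => ?_
  have h4 : lp.single 1 i (a i) = a i • (lp.single 1 i (1 : ℝ) : Ell1) := by
    rw [← lp.single_smul, smul_eq_mul, mul_one]
  rw [h4]
  exact Submodule.smul_mem _ _ (Submodule.subset_span ⟨i, rfl⟩)

/-! ### Norms with unit ball `B_E + S(B_{ℓ₂})` -/

/-- Describes the unit ball of `ℓ₂` by conditions that are closed under pointwise convergence. -/
theorem norm_ell2_le_one_iff {f : ℕ → ℝ} :
    (∃ a : Ell2, ‖a‖ ≤ 1 ∧ ∀ n, a n = f n) ↔ ∀ s : Finset ℕ, ∑ n ∈ s, f n ^ 2 ≤ 1 := by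
  constructor
  · rintro ⟨a, ha, haf⟩ s
    have h := lp.sum_rpow_le_norm_rpow (p := 2) (by simp) a s
    simp only [ENNReal.toReal_ofNat, Real.rpow_two, Real.norm_eq_abs, sq_abs, haf] at h
    exact h.trans (pow_le_one₀ (norm_nonneg _) ha)
  · intro h
    have hm : Memℓp (E := fun _ : ℕ => ℝ) f 2 := memℓp_gen' (C := 1) fun s => by
      simpa [Real.rpow_two] using h s
    refine ⟨⟨f, hm⟩, lp.norm_le_of_forall_sum_le (by simp) zero_le_one fun s => ?_, fun n => rfl⟩
    simpa [Real.rpow_two] using h s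

/-- The operator `S_Φ` is compact. -/
theorem isCompact_diagOp_image (Φ : Ell1) :
    IsCompact (diagOp Φ '' Metric.closedBall (0 : Ell2) 1) := by
  -- `Q` is the unit ball of `ℓ₂` in the product topology, a closed subset of `[-1, 1]^ℕ` and so
  -- compact by Tychonoff.
  set Q : Set (ℕ → ℝ) := {f | ∀ s : Finset ℕ, ∑ n ∈ s, f n ^ 2 ≤ 1} with hQ
  have hQb : ∀ f ∈ Q, ∀ n, |f n| ≤ 1 := fun f hf n => by
    have := hf {n}
    rw [Finset.sum_singleton] at this
    exact abs_le_one_iff_mul_self_le_one.mpr (by nlinarith)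
  have hQc : IsCompact Q := by
    refine (isCompact_univ_pi fun _ : ℕ => isCompact_Icc (a := (-1 : ℝ)) (b := 1)).of_isClosed_subset
      ?_ fun f hf n _ => abs_le.mp (hQb f hf n)
    rw [hQ, Set.ofPred_forall]
    exact isClosed_iInter fun s => isClosed_le (by fun_prop) continuous_const
  have hΦ := memℓp_one_iff.mp (lp.memℓp Φ)
  -- `G` is `S_Φ` on arbitrary sequences; on `Q` its terms are dominated by `|Φ n|`, so it is
  -- continuous for pointwise convergence.
  let G : (ℕ → ℝ) → Ell1 := fun f =>
    ∑' n, (f n) • (lp.single 1 n (Φ n) : Ell1)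
  have hG : ContinuousOn G Q := by
    refine continuousOn_tsum (u := fun n => ‖Φ n‖) (fun n => ?_) hΦ fun n f hf => ?_
    · exact ((continuous_apply n).smul continuous_const).continuousOn
    · rw [norm_smul, lp.norm_single (by simp)]
      exact mul_le_of_le_one_left (norm_nonneg _) (hQb f hf n)
  convert hQc.image_of_continuousOn hG using 1
  have hGa : ∀ a : Ell2, G (fun n => a n) = diagOp Φ a := fun a => by
    rw [← (lp.hasSum_single (E := fun _ : ℕ => ℝ) (p := 1) (by simp) (diagOp Φ a)).tsum_eq]
    refine tsum_congr fun n => ?_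
    rw [← lp.single_smul, smul_eq_mul, mul_comm]
    rfl
  ext x
  constructor
  · rintro ⟨a, ha, rfl⟩
    refine ⟨fun n => a n, norm_ell2_le_one_iff.mp ⟨a, by simpa using ha, fun _ => rfl⟩, hGa a⟩
  · rintro ⟨f, hf, rfl⟩
    obtain ⟨a, ha, haf⟩ := norm_ell2_le_one_iff.mpr hf
    refine ⟨a, by simpa using ha, ?_⟩
    rw [← hGa]
    congr 1
    funext n
    exact haf n

section SumBall

variable {E : Type} [NormedAddCommGroup E] [NormedSpace ℝ E]

/-- The set `B_E + S(B_{ℓ₂})`. -/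
def sumBall (S : Ell2 →L[ℝ] E) : Set E :=
  Metric.closedBall (0 : E) 1 + S '' Metric.closedBall (0 : Ell2) 1

theorem sumBall_convex (S : Ell2 →L[ℝ] E) : Convex ℝ (sumBall S) :=
  (convex_closedBall _ _).add ((convex_closedBall _ _).linear_image S.toLinearMap)

theorem neg_mem_sumBall (S : Ell2 →L[ℝ] E) : ∀ x ∈ sumBall S, -x ∈ sumBall S := by
  rintro _ ⟨y, hy, _, ⟨a, ha, rfl⟩, rfl⟩
  refine ⟨-y, by simpa using hy, -(S a), ⟨-a, by simpa using ha, by simp⟩, ?_⟩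
  simp [add_comm]

theorem closedBall_subset_sumBall (S : Ell2 →L[ℝ] E) :
    Metric.closedBall (0 : E) 1 ⊆ sumBall S :=
  fun x hx => ⟨x, hx, 0, ⟨0, by simp, by simp⟩, by simp⟩

theorem sumBall_mem_nhds (S : Ell2 →L[ℝ] E) : sumBall S ∈ nhds 0 :=
  Filter.mem_of_superset (Metric.closedBall_mem_nhds _ one_pos) (closedBall_subset_sumBall S)

theorem sumBall_subset_closedBall (S : Ell2 →L[ℝ] E) :
    sumBall S ⊆ Metric.closedBall (0 : E) (1 + ‖S‖) := by
  rintro _ ⟨y, hy, _, ⟨a, ha, rfl⟩, rfl⟩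
  rw [mem_closedBall_zero_iff] at *
  refine (norm_add_le _ _).trans (add_le_add hy ?_)
  exact (S.le_opNorm a).trans (mul_le_of_le_one_right (norm_nonneg _) ha)

/-- The equivalent norm given by the gauge of `B_E + S(B_{ℓ₂})`. -/
def sumNorm (S : Ell2 →L[ℝ] E) : EquivNorm E where
  toSeminorm := gaugeSeminorm
    ((balanced_iff_neg_mem (sumBall_convex S)).mpr fun x hx => neg_mem_sumBall S x hx)
    (sumBall_convex S) (absorbent_nhds_zero (sumBall_mem_nhds S))
  lower := by
    have h0 : 0 < 1 + ‖S‖ := by positivity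
    refine ⟨(1 + ‖S‖)⁻¹, inv_pos.mpr h0, fun x => ?_⟩
    have h := le_gauge_of_subset_closedBall (absorbent_nhds_zero (sumBall_mem_nhds S)) h0.le
      (sumBall_subset_closedBall S) (x := x)
    rw [inv_mul_eq_div]
    exact h
  upper := by
    refine ⟨1, fun x => ?_⟩
    have h := gauge_mono (absorbent_nhds_zero
      (Metric.closedBall_mem_nhds (0 : E) one_pos)) (closedBall_subset_sumBall S) x
    have h2 := gauge_closedBall (zero_le_one (α := ℝ)) x
    rw [h2] at h
    simpa using h

theorem gauge_sumBall_le (S : Ell2 →L[ℝ] E) {r : ℝ} (hr : 0 < r) {b : E} {a : Ell2}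
    (hb : ‖b‖ ≤ r) (ha : ‖a‖ ≤ r) : gauge (sumBall S) (b + S a) ≤ r := by
  refine gauge_le_of_mem hr.le ?_
  rw [Set.mem_smul_set_iff_inv_smul_mem₀ hr.ne', smul_add, ← map_smul]
  refine ⟨_, ?_, _, ⟨_, ?_, rfl⟩, rfl⟩ <;>
  · rw [mem_closedBall_zero_iff, norm_smul, norm_inv, Real.norm_of_nonneg hr.le,
      inv_mul_le_one₀ hr]
    assumption

/-- Compactness of `S(B_{ℓ₂})` makes the sum of the two balls closed, so the infimum in the gauge is
attained. -/
theorem exists_repr_of_gauge_sumBall (S : Ell2 →L[ℝ] E)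
    (hS : IsCompact (S '' Metric.closedBall (0 : Ell2) 1)) (x : E) :
    ∃ b a, ‖b‖ ≤ gauge (sumBall S) x ∧ ‖a‖ ≤ gauge (sumBall S) x ∧ x = b + S a := by
  have hcl : IsClosed (sumBall S) := Metric.isClosed_closedBall.add_right_of_isCompact hS
  set r := gauge (sumBall S) x with hr
  rcases (gauge_nonneg (s := sumBall S) x).eq_or_lt with h0 | h0
  · obtain ⟨c, hc, hl⟩ := (sumNorm S).lower
    have hx : c * ‖x‖ ≤ gauge (sumBall S) x := hl x
    have hx0 : ‖x‖ = 0 := by nlinarith [norm_nonneg x]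
    exact ⟨0, 0, by simp [hr, ← h0], by simp [hr, ← h0], by simpa using hx0⟩
  · have h1 : gauge (sumBall S) (r⁻¹ • x) ≤ 1 := by
      rw [gauge_smul_of_nonneg (by positivity), smul_eq_mul, ← hr, inv_mul_cancel₀ h0.ne']
    rw [gauge_le_one_iff_mem_closure (sumBall_convex S) (sumBall_mem_nhds S), hcl.closure_eq] at h1
    obtain ⟨b, hb, _, ⟨a, ha, rfl⟩, hba⟩ := h1
    rw [mem_closedBall_zero_iff] at hb ha
    refine ⟨r • b, r • a, ?_, ?_, ?_⟩
    · rw [norm_smul, Real.norm_of_nonneg h0.le]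
      exact mul_le_of_le_one_right h0.le hb
    · rw [norm_smul, Real.norm_of_nonneg h0.le]
      exact mul_le_of_le_one_right h0.le ha
    · rw [map_smul, ← smul_add]
      change x = r • (b + S a)
      rw [show b + S a = r⁻¹ • x from hba, smul_inv_smul₀ h0.ne']

end SumBall

/-! ### Strict monotonicity of the norms `|·|_Φ` -/

theorem diagOp_apply (Φ : Ell1) (a : Ell2) (n : ℕ) : diagOp Φ a n = Φ n * a n := rfl

theorem diagOp_single (Φ : Ell1) (n : ℕ) (t : ℝ) :
    diagOp Φ (lp.single 2 n t) = lp.single 1 n (Φ n * t) := by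
  ext k
  rw [diagOp_apply]
  by_cases h : k = n
  · subst h; simp
  · rw [lp.single_apply_ne _ _ _ h, lp.single_apply_ne _ _ _ h, mul_zero]

theorem Ell1.norm_sub_single (b : Ell1) (n : ℕ) (t : ℝ) :
    ‖b - lp.single 1 n t‖ = ‖b‖ - ‖b n‖ + ‖b n - t‖ := by
  have hs := memℓp_one_iff.mp (lp.memℓp b)
  have hs' := memℓp_one_iff.mp (lp.memℓp (b - lp.single 1 n t))
  rw [Ell1.norm_eq, Ell1.norm_eq, hs.tsum_eq_add_tsum_ite n, hs'.tsum_eq_add_tsum_ite n]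
  have h : ∀ k, (if k = n then 0 else ‖(b - lp.single 1 n t : Ell1) k‖) =
      if k = n then 0 else ‖b k‖ := fun k => by
    split_ifs with hk
    · rfl
    · rw [lp.coeFn_sub, Pi.sub_apply, lp.single_apply_ne _ _ _ hk, sub_zero]
  rw [tsum_congr h, lp.coeFn_sub, Pi.sub_apply, lp.single_apply_self]
  ring

theorem Ell2.norm_sub_single_lt (a : Ell2) (n : ℕ) (t : ℝ) (h : ‖a n - t‖ < ‖a n‖) :
    ‖a - lp.single 2 n t‖ < ‖a‖ := by
  have key : ∀ c : Ell2, ‖c‖ ^ 2 = ∑' k, ‖c k‖ ^ 2 ∧ Summable fun k => ‖c k‖ ^ 2 := fun c => by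
    have h1 := lp.norm_rpow_eq_tsum (p := 2) (by simp) c
    have h2 := (lp.memℓp c).summable (by simp)
    simp only [ENNReal.toReal_ofNat, Real.rpow_two] at h1 h2
    exact ⟨h1, h2⟩
  refine lt_of_pow_lt_pow_left₀ 2 (norm_nonneg _) ?_
  rw [(key _).1, (key a).1]
  refine Summable.tsum_lt_tsum (i := n) (fun k => ?_) ?_ (key _).2 (key _).2
  · by_cases hk : k = n
    · subst hk
      rw [lp.coeFn_sub, Pi.sub_apply, lp.single_apply_self]
      gcongr
    · rw [lp.coeFn_sub, Pi.sub_apply, lp.single_apply_ne _ _ _ hk, sub_zero]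
  · rw [lp.coeFn_sub, Pi.sub_apply, lp.single_apply_self]
    gcongr

/-- Slack in `b` allows moving a small fraction `δ` of `S_Φ a` into the `ℓ₁` part; both parts then
have norm at most `(1 - δ) r`. -/
theorem gauge_phiBall_lt_of_fst_lt (Φ : Ell1) {r : ℝ} {b : Ell1} {a : Ell2}
    (hb : ‖b‖ < r) (ha : ‖a‖ ≤ r) : gauge (phiBall Φ) (b + diagOp Φ a) < r := by
  have hr : 0 < r := (norm_nonneg b).trans_lt hb
  set M := r * (1 + ‖diagOp Φ‖) with hM
  have hMpos : 0 < M := by positivity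
  -- By the choice of `M`, this says `‖b‖ + δ ‖S_Φ‖ r < (1 - δ) r`.
  obtain ⟨δ, hδ, hδ1, hδM⟩ : ∃ δ : ℝ, 0 < δ ∧ δ < 1 ∧ ‖b‖ + δ * M < r := by
    have h2 : 0 < (r - ‖b‖) / M := div_pos (by linarith) hMpos
    refine ⟨min (1 / 2) ((r - ‖b‖) / M / 2), by positivity,
      (min_le_left _ _).trans_lt (by norm_num), ?_⟩
    have h3 : min (1 / 2) ((r - ‖b‖) / M / 2) * M ≤ (r - ‖b‖) / M / 2 * M :=
      mul_le_mul_of_nonneg_right (min_le_right _ _) hMpos.le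
    have h4 : (r - ‖b‖) / M / 2 * M = (r - ‖b‖) / 2 := by field_simp
    linarith
  have he : b + diagOp Φ a = (b + δ • diagOp Φ a) + diagOp Φ ((1 - δ) • a) := by
    rw [map_smul, sub_smul, one_smul]
    abel
  rw [he]
  refine (gauge_sumBall_le (diagOp Φ) (r := (1 - δ) * r) (by nlinarith) ?_ ?_).trans_lt
    (by nlinarith)
  · refine (norm_add_le _ _).trans ?_
    rw [norm_smul, Real.norm_of_nonneg hδ.le]
    have h1 : ‖diagOp Φ a‖ ≤ ‖diagOp Φ‖ * r :=
      ((diagOp Φ).le_opNorm a).trans (mul_le_mul_of_nonneg_left ha (norm_nonneg _))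
    have h2 := mul_le_mul_of_nonneg_left h1 hδ.le
    nlinarith
  · rw [norm_smul, Real.norm_of_nonneg (by linarith)]
    exact mul_le_mul_of_nonneg_left ha (by linarith)

theorem exists_shrink (x : ℝ) (η : ℝ) (hη : 0 < η) (hx : x ≠ 0) :
    ∃ t, |t| ≤ η ∧ ‖x - t‖ < ‖x‖ := by
  have hx' := abs_pos.mpr hx
  refine ⟨min (η / |x|) 1 * x, ?_, ?_⟩
  · have h0 : 0 ≤ min (η / |x|) 1 := by positivity
    rw [abs_mul, abs_of_nonneg h0]
    calc min (η / |x|) 1 * |x| ≤ η / |x| * |x| :=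
          mul_le_mul_of_nonneg_right (min_le_left _ _) (abs_nonneg _)
      _ = η := by field_simp
  · have h0 : 0 < min (η / |x|) 1 := by positivity
    have h1 : min (η / |x|) 1 ≤ 1 := min_le_right _ _
    rw [show x - min (η / |x|) 1 * x = (1 - min (η / |x|) 1) * x by ring, norm_mul,
      Real.norm_of_nonneg (by linarith), Real.norm_eq_abs]
    nlinarith

/-- Slack in `a` absorbs a little of a nonzero coordinate of `b`, which is possible because `Φ n ≠
0`; this reduces to slack in `b`. -/
theorem gauge_phiBall_lt_of_snd_lt (Φ : Ell1) (hΦ : ∀ n, Φ n ≠ 0) {r : ℝ} {b : Ell1} {a : Ell2}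
    (hb : ‖b‖ ≤ r) (ha : ‖a‖ < r) : gauge (phiBall Φ) (b + diagOp Φ a) < r := by
  have hr : 0 < r := (norm_nonneg a).trans_lt ha
  rcases hb.lt_or_eq with hb' | hb'
  · exact gauge_phiBall_lt_of_fst_lt Φ hb' ha.le
  obtain ⟨n, hn⟩ : ∃ n, b n ≠ 0 := by
    by_contra! hc
    have : b = 0 := lp.ext (funext hc)
    rw [this, norm_zero] at hb'
    exact hr.ne hb'
  have hη : 0 < (r - ‖a‖) * |Φ n| := mul_pos (by linarith) (abs_pos.mpr (hΦ n))
  obtain ⟨t, ht, hbt⟩ := exists_shrink (b n) _ hη hn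
  have he : b + diagOp Φ a =
      (b - lp.single 1 n t) + diagOp Φ (a + lp.single 2 n (t / Φ n)) := by
    rw [map_add, diagOp_single, mul_div_cancel₀ _ (hΦ n)]
    abel
  rw [he]
  refine gauge_phiBall_lt_of_fst_lt Φ ?_ ?_
  · rw [Ell1.norm_sub_single]
    linarith
  · refine (norm_add_le _ _).trans ?_
    rw [lp.norm_single (by simp), norm_div, Real.norm_eq_abs, Real.norm_eq_abs]
    have := (div_le_iff₀ (abs_pos.mpr (hΦ n))).mpr ht
    linarith

/-- Strict monotonicity: since `u n = b n + Φ n a n ≥ 2 t`, one of the two summands is at least `t`,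
and removing `t` from it creates slack in that part. -/
theorem gauge_phiBall_sub_single_lt (Φ : Ell1) (hΦ : ∀ n, 0 < Φ n) (u : Ell1) (n : ℕ) {t : ℝ}
    (ht : 0 < t) (htu : 2 * t ≤ u n) :
    gauge (phiBall Φ) (u - lp.single 1 n t) < gauge (phiBall Φ) u := by
  obtain ⟨b, a, hb, ha, hu⟩ :=
    exists_repr_of_gauge_sumBall (diagOp Φ) (isCompact_diagOp_image Φ) u
  change ‖b‖ ≤ gauge (phiBall Φ) u at hb
  change ‖a‖ ≤ gauge (phiBall Φ) u at ha
  set r := gauge (phiBall Φ) u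
  have hun : u n = b n + Φ n * a n := by rw [hu]; rfl
  rcases le_total t (b n) with h | h
  · have he : u - lp.single 1 n t = (b - lp.single 1 n t) + diagOp Φ a := by rw [hu]; abel
    rw [he]
    refine gauge_phiBall_lt_of_fst_lt Φ ?_ ha
    rw [Ell1.norm_sub_single, Real.norm_of_nonneg (by linarith), Real.norm_of_nonneg (by linarith)]
    linarith
  · have he : u - lp.single 1 n t = b + diagOp Φ (a - lp.single 2 n (t / Φ n)) := by
      rw [map_sub, diagOp_single, mul_div_cancel₀ _ (hΦ n).ne', hu]
      abel
    rw [he]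
    refine gauge_phiBall_lt_of_snd_lt Φ (fun k => (hΦ k).ne') hb
      ((Ell2.norm_sub_single_lt a n _ ?_).trans_le ha)
    have h1 : t / Φ n ≤ a n := by
      rw [div_le_iff₀ (hΦ n)]
      linarith
    have h2 : 0 < t / Φ n := div_pos ht (hΦ n)
    rw [Real.norm_of_nonneg (by linarith), Real.norm_of_nonneg (by linarith)]
    linarith

/-- If `u n > 0 > w n`, moving a small amount `t` from `u n` to `w n` keeps `u + w` but strictly
decreases both norms, which contradicts equality. -/
theorem mul_nonneg_of_norm_add_eq (Φ : Ell1) (hΦ : ∀ n, 0 < Φ n) (u w : (phiNorm Φ).Space)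
    (h : ‖u + w‖ = ‖u‖ + ‖w‖) (n : ℕ) :
    0 ≤ (phiNorm Φ).toLin.symm u n * (phiNorm Φ).toLin.symm w n := by
  have main : ∀ u w : Ell1, gauge (phiBall Φ) u + gauge (phiBall Φ) w ≤
      gauge (phiBall Φ) (u + w) → 0 < u n → w n < 0 → False := fun u w huw hu hw => by
    set t := min (u n) (-w n) / 2 with ht
    have ht0 : 0 < t := by
      have : 0 < min (u n) (-w n) := lt_min hu (by linarith)
      positivity
    have h1 := gauge_phiBall_sub_single_lt Φ hΦ u n ht0
      (by linarith [min_le_left (u n) (-w n)])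
    have h2 := gauge_phiBall_sub_single_lt Φ hΦ (-w) n ht0 (by
      rw [lp.coeFn_neg, Pi.neg_apply]
      linarith [min_le_right (u n) (-w n)])
    rw [gauge_neg (phiBall_neg Φ), ← gauge_neg (phiBall_neg Φ)] at h2
    have h3 := gauge_add_le (phiBall_convex Φ) (phiBall_absorbent Φ) (u - lp.single 1 n t)
      (-(-w - lp.single 1 n t))
    rw [show u - lp.single 1 n t + -(-w - lp.single 1 n t) = u + w by abel] at h3
    linarith
  have h' : gauge (phiBall Φ) ((phiNorm Φ).toLin.symm u + (phiNorm Φ).toLin.symm w) =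
      gauge (phiBall Φ) ((phiNorm Φ).toLin.symm u) +
        gauge (phiBall Φ) ((phiNorm Φ).toLin.symm w) := h
  by_contra! hneg
  rcases mul_neg_iff.mp hneg with ⟨h1, h2⟩ | ⟨h1, h2⟩
  · exact main _ _ h'.ge h1 h2
  · refine main _ _ ?_ h2 h1
    rw [add_comm, ← h', add_comm]

/-! ### Renormed spaces -/

namespace EquivNorm

variable {E : Type} [NormedAddCommGroup E] [NormedSpace ℝ E]

/-- The identity map from the renormed space back to `E`, as a continuous linear map. -/
def symmCLM (q : EquivNorm E) : q.Space →L[ℝ] E :=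
  q.toLin.symm.toLinearMap.mkContinuousOfExistsBound (by
    obtain ⟨c, hc, hl⟩ := q.lower
    refine ⟨c⁻¹, fun x => ?_⟩
    rw [inv_mul_eq_div, le_div_iff₀ hc, mul_comm]
    exact hl _)

theorem toCLM_symmCLM (q : EquivNorm E) (x : q.Space) : q.toCLM (q.symmCLM x) = x := rfl

end EquivNorm

/-! ### Splitting functionals on a sum norm -/

/-- Hahn–Banach on `V × L` with the sublinear function `N + ‖·‖`, extending `h` from the graph of
`A`. -/
theorem exists_dual_split {V L : Type} [NormedAddCommGroup V] [NormedSpace ℝ V]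
    [NormedAddCommGroup L] [NormedSpace ℝ L] (N : Seminorm ℝ V) (A : V →ₗ[ℝ] L) (h : V →ₗ[ℝ] ℝ)
    (hh : ∀ x, h x ≤ N x + ‖A x‖) :
    ∃ (f : V →ₗ[ℝ] ℝ) (g : L →ₗ[ℝ] ℝ), (∀ x, f x ≤ N x) ∧ (∀ u, g u ≤ ‖u‖) ∧
      ∀ x, h x = f x + g (A x) := by
  let G : V →ₗ[ℝ] V × L := LinearMap.id.prod A
  have hG : Function.Injective G := fun x y hxy => (Prod.ext_iff.mp hxy).1
  let e := LinearEquiv.ofInjective G hG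
  obtain ⟨F, hF, hFN⟩ := exists_extension_of_le_sublinear
    ⟨LinearMap.range G, h ∘ₗ e.symm.toLinearMap⟩ (fun z : V × L => N z.1 + ‖z.2‖)
    (fun c hc z => by
      simp only [Prod.smul_fst, Prod.smul_snd, map_smul_eq_mul, norm_smul,
        Real.norm_of_nonneg hc.le]
      ring)
    (fun z w => by
      have h1 := map_add_le_add N z.1 w.1
      have h2 := norm_add_le z.2 w.2
      simp only [Prod.fst_add, Prod.snd_add]
      linarith)
    (by
      rintro ⟨_, x, rfl⟩
      have : e.symm ⟨G x, x, rfl⟩ = x := e.symm_apply_eq.mpr rfl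
      change h (e.symm ⟨G x, x, rfl⟩) ≤ _
      rw [this]
      exact hh x)
  refine ⟨F ∘ₗ LinearMap.inl ℝ V L, F ∘ₗ LinearMap.inr ℝ V L, fun x => ?_, fun u => ?_,
    fun x => ?_⟩
  · simpa using hFN (x, 0)
  · simpa using hFN (0, u)
  · have h1 := hF ⟨G x, x, rfl⟩
    have h2 : e.symm ⟨G x, x, rfl⟩ = x := e.symm_apply_eq.mpr rfl
    change F (x, A x) = h (e.symm ⟨G x, x, rfl⟩) at h1
    rw [h2] at h1
    simp only [LinearMap.comp_apply, LinearMap.inl_apply, LinearMap.inr_apply]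
    rw [← h1, ← map_add, Prod.mk_add_mk, add_zero, zero_add]

theorem abs_le_of_forall_le {V : Type} [AddCommGroup V] [Module ℝ V] (N : Seminorm ℝ V)
    (f : V →ₗ[ℝ] ℝ) (h : ∀ x, f x ≤ N x) (x : V) : |f x| ≤ N x := by
  refine abs_le'.mpr ⟨h x, ?_⟩
  rw [← map_neg, ← map_neg_eq_map N]
  exact h _

/-- If `‖x‖ = N(x) + ‖A x‖` on `V` and `B` represents the bitranspose of `A`, then `B` preserves
equality in the triangle inequality. -/
theorem norm_bitranspose_add_eq {V L : Type} [NormedAddCommGroup V] [NormedSpace ℝ V]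
    [NormedAddCommGroup L] [NormedSpace ℝ L] (N : Seminorm ℝ V) (A : V →L[ℝ] L)
    (hN : ∀ x, ‖x‖ = N x + ‖A x‖) (B : StrongDual ℝ (StrongDual ℝ V) → L)
    (hB : ∀ z (g : StrongDual ℝ L), z (g.comp A) = g (B z))
    (x y : StrongDual ℝ (StrongDual ℝ V)) (hxy : ‖x + y‖ = ‖x‖ + ‖y‖) :
    ‖B (x + y)‖ = ‖B x‖ + ‖B y‖ := by
  -- `B` is not assumed linear; additivity follows from `hB`, since functionals separate points of
  -- `L`.
  have hadd : B (x + y) = B x + B y := by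
    refine (SeparatingDual.eq_iff_forall_dual_eq (R := ℝ)).mpr fun g => ?_
    rw [map_add, ← hB, ← hB, ← hB, add_apply]
  refine le_antisymm (hadd ▸ norm_add_le _ _) (le_of_forall_pos_sub_le fun δ hδ => ?_)
  have hNle : ∀ v, N v ≤ ‖v‖ := fun v => by rw [hN]; linarith [norm_nonneg (A v)]
  obtain ⟨h, hh1, hh⟩ : ∃ h : StrongDual ℝ V, ‖h‖ ≤ 1 ∧ ‖x + y‖ - δ ≤ (x + y) h := by
    by_contra! hc
    have h0 : 0 < ‖x + y‖ - δ := by simpa using hc 0 (by simp)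
    have : ‖x + y‖ ≤ ‖x + y‖ - δ := by
      refine ContinuousLinearMap.opNorm_le_of_unit_norm h0.le fun h hh => ?_
      rw [Real.norm_eq_abs]
      refine abs_le'.mpr ⟨(hc h hh.le).le, ?_⟩
      rw [← map_neg]
      exact (hc (-h) (by rw [norm_neg, hh])).le
    linarith
  obtain ⟨f, g, hf, hg, hfg⟩ := exists_dual_split N A.toLinearMap h.toLinearMap fun v => by
    have h1 := (le_abs_self _).trans (h.le_opNorm v)
    have h2 := mul_le_mul_of_nonneg_right hh1 (norm_nonneg v)
    rw [one_mul, hN] at h2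
    rw [hN] at h1
    exact h1.trans h2
  let f' : StrongDual ℝ V := f.mkContinuous 1 fun v => by
    rw [one_mul]
    exact (abs_le_of_forall_le N f hf v).trans (hNle v)
  let g' : StrongDual ℝ L := g.mkContinuous 1 fun u => by
    rw [one_mul]
    exact abs_le_of_forall_le (normSeminorm ℝ L) g hg u
  have hfg' : h = f' + g'.comp A := ContinuousLinearMap.ext hfg
  -- Replace the second part of the splitting by a functional `k` norming `B z`: `f + k ∘ A` still
  -- has norm at most one. Applied to `x` and to `y` with the same `f`, this gives the estimate up
  -- to `δ`.
  have bound : ∀ z : StrongDual ℝ (StrongDual ℝ V), z f' + ‖B z‖ ≤ ‖z‖ := fun z => by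
    obtain ⟨k, hk, hkz⟩ := exists_dual_vector'' ℝ (B z)
    have hkz' : k (B z) = ‖B z‖ := hkz
    rw [← hkz', ← hB, ← map_add]
    refine (le_abs_self _).trans ((z.le_opNorm _).trans (mul_le_of_le_one_right (norm_nonneg z) ?_))
    refine ContinuousLinearMap.opNorm_le_bound _ zero_le_one fun v => ?_
    rw [one_mul, hN]
    refine (norm_add_le _ _).trans (add_le_add (abs_le_of_forall_le N f hf v) ?_)
    exact (k.le_opNorm _).trans (mul_le_of_le_one_left (norm_nonneg _) hk)
  have h1 : (x + y) h = x f' + y f' + g' (B (x + y)) := by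
    rw [hfg', map_add, hB, add_apply]
  have h2 : g' (B (x + y)) ≤ ‖B (x + y)‖ := hg _
  linarith [bound x, bound y]

/-! ### Strict convexity of the bidual of `𝕏`. -/

namespace Choices

variable (D : Choices)

/-- The functionals `v*_{n,m}` on the renormed space `𝕏`. -/
def vX (n m : ℕ) : StrongDual ℝ D.X := (D.v n m).comp D.p.symmCLM

theorem norm_vX_le (n m : ℕ) : ‖D.vX n m‖ ≤ ‖D.p.symmCLM‖ :=
  (ContinuousLinearMap.opNorm_comp_le _ _).trans
    (mul_le_of_le_one_left (norm_nonneg _) (D.norm_v_le n m))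

/-- The weights of the operator `R_m`. -/
def weight (m n : ℕ) : ℝ := (m + 1 : ℝ) / 2 ^ (m + 1) * (1 / 2 ^ (n + 1))

theorem weight_pos (m n : ℕ) : 0 < weight m n := by
  unfold weight
  positivity

theorem summable_weight_mul {f : ℕ → ℝ} {C : ℝ} (hf : ∀ n, ‖f n‖ ≤ C) (m : ℕ) :
    Summable fun n => ‖weight m n * f n‖ := by
  refine Summable.of_nonneg_of_le (fun _ => norm_nonneg _) (fun n => ?_)
    ((summable_geom.mul_left ((m + 1 : ℝ) / 2 ^ (m + 1))).mul_right C)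
  rw [norm_mul, Real.norm_of_nonneg (weight_pos m n).le]
  exact mul_le_mul_of_nonneg_left (hf n) (weight_pos m n).le

/-- The operator `R_m`, defined on `𝕏`. -/
def RmX (m : ℕ) : D.X →L[ℝ] D.L m :=
  LinearMap.mkContinuous (D.Rm m ∘ₗ D.p.symmCLM.toLinearMap)
    ((m + 1 : ℝ) / 2 ^ (m + 1) * ‖D.p.symmCLM‖) fun x => by
      rw [mul_assoc]
      exact (D.norm_Rm_le m _).trans
        (mul_le_mul_of_nonneg_left (D.p.symmCLM.le_opNorm x) (by positivity))

theorem norm_bidual_apply_vX_le (z : StrongDual ℝ (StrongDual ℝ D.X)) (m n : ℕ) :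
    ‖z (D.vX n m)‖ ≤ ‖z‖ * ‖D.p.symmCLM‖ :=
  (z.le_opNorm _).trans (mul_le_mul_of_nonneg_left (D.norm_vX_le n m) (norm_nonneg _))

/-- The bitranspose of `R_m` takes values in `ℓ₁`. -/
def bitransposeRm (m : ℕ) (z : StrongDual ℝ (StrongDual ℝ D.X)) : D.L m :=
  (phiNorm (D.Phi m)).toLin ⟨fun n => weight m n * z (D.vX n m),
    memℓp_one_iff.mpr (summable_weight_mul (D.norm_bidual_apply_vX_le z m) m)⟩

theorem hasSum_dual_ell1 (Φ : Ell1) (g : StrongDual ℝ (phiNorm Φ).Space) (u : Ell1) :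
    HasSum (fun n => u n * g ((phiNorm Φ).toCLM (lp.single 1 n 1)))
      (g ((phiNorm Φ).toCLM u)) := by
  have h := (lp.hasSum_single (E := fun _ : ℕ => ℝ) (p := 1) (by simp) u).mapL
    (g.comp (phiNorm Φ).toCLM)
  refine h.congr_fun fun n => ?_
  have h1 : lp.single 1 n (u n) = u n • (lp.single 1 n (1 : ℝ) : Ell1) := by
    rw [← lp.single_smul, smul_eq_mul, mul_one]
  rw [h1, map_smul]
  rfl

/-- The series expressing `g ∘ R_m` through the `v*_{n,m}` converges in norm because the weights are
summable, so `z` may be applied term by term. -/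
theorem bitransposeRm_spec (m : ℕ) (z : StrongDual ℝ (StrongDual ℝ D.X))
    (g : StrongDual ℝ (D.L m)) : z (g.comp (D.RmX m)) = g (D.bitransposeRm m z) := by
  set γ : ℕ → ℝ := fun n => g ((phiNorm (D.Phi m)).toCLM (lp.single 1 n 1)) with hγ
  obtain ⟨C, hC⟩ : ∃ C, ∀ n, ‖γ n‖ ≤ C := by
    refine ⟨‖g.comp (phiNorm (D.Phi m)).toCLM‖, fun n => ?_⟩
    have := (g.comp (phiNorm (D.Phi m)).toCLM).le_opNorm (lp.single 1 n 1)
    rwa [lp.norm_single (by simp), norm_one, mul_one] at this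
  have hsum : Summable fun n => (weight m n * γ n) • D.vX n m := by
    refine Summable.of_norm_bounded ((summable_weight_mul hC m).mul_right ‖D.p.symmCLM‖)
      fun n => ?_
    rw [norm_smul]
    exact mul_le_mul_of_nonneg_left (D.norm_vX_le n m) (norm_nonneg _)
  have hcomp : HasSum (fun n => (weight m n * γ n) • D.vX n m) (g.comp (D.RmX m)) := by
    convert hsum.hasSum
    ext x
    have h1 := hsum.hasSum.mapL (ContinuousLinearMap.apply ℝ ℝ x)
    have h2 := hasSum_dual_ell1 (D.Phi m) g (D.Rcoord m (D.p.symmCLM x))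
    refine h2.unique (h1.congr_fun fun n => ?_)
    change weight m n * D.vX n m x * γ n = weight m n * γ n * D.vX n m x
    ring
  refine (hcomp.mapL z).unique ((hasSum_dual_ell1 (D.Phi m) g
    ((phiNorm (D.Phi m)).symmCLM (D.bitransposeRm m z))).congr_fun fun n => ?_)
  rw [map_smul]
  change weight m n * γ n * z (D.vX n m) = weight m n * z (D.vX n m) * γ n
  ring

theorem norm_R_eq (x : D.q.Space) : ‖D.R x‖ = ∑' m, ‖D.Rm m x‖ := by
  have h0 := lp.norm_eq_tsum_rpow (p := 1) (by simp) (D.R x)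
  simp only [ENNReal.toReal_one, Real.rpow_one, div_one] at h0
  exact h0

theorem norm_X_eq (x : D.X) : ‖x‖ = ‖D.p.symmCLM x‖ + ∑' m, ‖D.RmX m x‖ := by
  change ‖D.p.symmCLM x‖ + ‖D.R (D.p.symmCLM x)‖ = _
  rw [norm_R_eq]
  rfl

theorem summable_norm_RmX (x : D.X) : Summable fun m => ‖D.RmX m x‖ :=
  D.norm_Rm_summable (D.p.symmCLM x)

theorem tsum_norm_RmX_add_le (x y : D.X) : ∑' m, ‖D.RmX (m + 1) (x + y)‖ ≤
    ∑' m, ‖D.RmX (m + 1) x‖ + ∑' m, ‖D.RmX (m + 1) y‖ := by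
  have hs : ∀ x, Summable fun m => ‖D.RmX (m + 1) x‖ := fun x =>
    (summable_nat_add_iff (f := fun m => ‖D.RmX m x‖) 1).mpr (D.summable_norm_RmX x)
  rw [← (hs x).tsum_add (hs y)]
  refine (hs _).tsum_le_tsum (fun m => ?_) ((hs x).add (hs y))
  rw [map_add]
  exact norm_add_le _ _

theorem tsum_norm_RmX_smul (c : ℝ) (x : D.X) :
    ∑' m, ‖D.RmX (m + 1) (c • x)‖ = ‖c‖ * ∑' m, ‖D.RmX (m + 1) x‖ := by
  rw [← tsum_mul_left]
  refine tsum_congr fun m => ?_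
  rw [map_smul]
  exact norm_smul c (D.RmX (m + 1) x)

/-- The part of the norm of `𝕏` complementary to the first summand `|R_0 x|_0`. -/
def restSeminorm : Seminorm ℝ D.X :=
  Seminorm.of (fun x => ‖D.p.symmCLM x‖ + ∑' m, ‖D.RmX (m + 1) x‖)
    (fun x y => by
      have h1 := D.tsum_norm_RmX_add_le x y
      have h2 : ‖D.p.symmCLM (x + y)‖ ≤ ‖D.p.symmCLM x‖ + ‖D.p.symmCLM y‖ :=
        norm_add_le (D.p.symmCLM x) (D.p.symmCLM y)
      linarith)
    (fun c x => by
      have h1 := D.tsum_norm_RmX_smul c x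
      have h2 : ‖D.p.symmCLM (c • x)‖ = ‖c‖ * ‖D.p.symmCLM x‖ := norm_smul c (D.p.symmCLM x)
      rw [h1, h2, mul_add])

theorem norm_X_eq_rest_add (x : D.X) : ‖x‖ = D.restSeminorm x + ‖D.RmX 0 x‖ := by
  change _ = ‖D.p.symmCLM x‖ + ∑' m, ‖D.RmX (m + 1) x‖ + _
  rw [norm_X_eq, (D.summable_norm_RmX x).tsum_eq_zero_add]
  ring

theorem v_ne_zero (n m : ℕ) : D.v n m ≠ 0 := by
  intro h
  have h1 : (lp.single 1 (n, m) (1 : ℝ) : Ell1Prod) = 0 := D.T_inj (h.trans (map_zero D.T).symm)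
  have h2 := congrArg norm h1
  rw [lp.norm_single (by simp)] at h2
  simp at h2

/-- Injectivity of `T` enters here; positivity of `Φ` is what strict monotonicity of the norm needs.
-/
theorem Phi_pos (m n : ℕ) : 0 < D.Phi m n := by
  change 0 < 1 / 2 ^ (m + 1) * (1 / 2 ^ (n + 1)) * ‖D.v n m‖
  have := norm_pos_iff.mpr (D.v_ne_zero n m)
  positivity

/-- A closed homogeneous property of functionals which holds for all `v*_{n,m}`, with `m` fixed,
holds for all functionals. -/
theorem induction_dual (m : ℕ) {P : StrongDual ℝ D.q.Space → Prop}
    (hP : IsClosed {f | P f}) (hsmul : ∀ (c : ℝ) f, P f → P (c • f))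
    (hv : ∀ n, P (D.v n m)) (f : StrongDual ℝ D.q.Space) : P f := by
  have hY : (D.Y : Set (StrongDual ℝ D.q.Space)) ⊆ {f | P f} := fun y hy => by
    rw [Set.mem_ofPred_eq]
    by_cases hy0 : y = 0
    · rw [hy0, ← zero_smul ℝ (D.v 0 m)]
      exact hsmul _ _ (hv 0)
    rw [← smul_inv_smul₀ (norm_ne_zero_iff.mpr hy0) y]
    refine hsmul _ _ ?_
    have h1 := D.T_dense m (show ‖y‖⁻¹ • y ∈ _ from ⟨D.Y.smul_mem _ hy, by
      rw [norm_smul, norm_inv, norm_norm, inv_mul_cancel₀ (norm_ne_zero_iff.mpr hy0)]⟩)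
    refine hP.closure_subset_iff.mpr ?_ h1
    rintro _ ⟨n, rfl⟩
    exact hsmul _ _ (hv n)
  exact hP.closure_subset_iff.mpr hY (D.dense f)

theorem sameRay_bidual (x y : StrongDual ℝ (StrongDual ℝ D.X)) (hxy : ‖x + y‖ = ‖x‖ + ‖y‖) :
    SameRay ℝ x y := by
  have h1 := norm_bitranspose_add_eq D.restSeminorm (D.RmX 0) D.norm_X_eq_rest_add
    (D.bitransposeRm 0) (D.bitransposeRm_spec 0) x y hxy
  have hadd : D.bitransposeRm 0 (x + y) = D.bitransposeRm 0 x + D.bitransposeRm 0 y := by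
    refine (SeparatingDual.eq_iff_forall_dual_eq (R := ℝ)).mpr fun g => ?_
    rw [map_add, ← bitransposeRm_spec, ← bitransposeRm_spec, ← bitransposeRm_spec, add_apply]
  rw [hadd] at h1
  have h2 : ∀ n, 0 ≤ x (D.vX n 0) * y (D.vX n 0) := fun n => by
    have h3 := mul_nonneg_of_norm_add_eq (D.Phi 0) (D.Phi_pos 0) _ _ h1 n
    change 0 ≤ weight 0 n * x (D.vX n 0) * (weight 0 n * y (D.vX n 0)) at h3
    rw [mul_mul_mul_comm] at h3
    exact nonneg_of_mul_nonneg_right h3 (mul_pos (weight_pos 0 n) (weight_pos 0 n))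
  -- `J` moves functionals from `(c₀, q)*`, where the directions are dense, to `𝕏*`.
  let J : StrongDual ℝ D.q.Space →L[ℝ] StrongDual ℝ D.X :=
    (ContinuousLinearMap.compL ℝ D.X D.q.Space ℝ).flip D.p.symmCLM
  refine sameRay_of_mul_nonneg x y fun f => ?_
  have h4 := D.induction_dual 0 (P := fun f => 0 ≤ x (J f) * y (J f))
    (isClosed_le (by fun_prop) (by fun_prop))
    (fun c f hf => by
      simp only [map_smul, smul_eq_mul]
      rw [mul_mul_mul_comm]
      exact mul_nonneg (mul_self_nonneg c) hf) h2 (f.comp D.p.toCLM)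
  exact h4

instance strictConvexSpace_bidual : StrictConvexSpace ℝ (StrongDual ℝ (StrongDual ℝ D.X)) :=
  StrictConvexSpace.of_norm_add fun x y hx hy hxy => D.sameRay_bidual x y (by
    rw [hx, hy, hxy]
    norm_num)

end Choices

theorem geometry_of_choices (D : Choices) :
    StrictConvexSpace ℝ (StrongDual ℝ (StrongDual ℝ D.X)) ∧
      IsSmoothSpace (StrongDual ℝ D.X) ∧ StrictConvexSpace ℝ D.X :=
  ⟨inferInstance, isSmoothSpace_of_strictConvexSpace_dual _, strictConvexSpace_of_bidual _⟩

/-! ### The dual of the norm with unit ball `B_E + S(B_{ℓ₂})` -/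

theorem opNorm_le_of_forall_closedBall_le {E : Type} [NormedAddCommGroup E] [NormedSpace ℝ E]
    (f : StrongDual ℝ E) {C : ℝ} (h : ∀ x, ‖x‖ ≤ 1 → f x ≤ C) : ‖f‖ ≤ C := by
  have hC : 0 ≤ C := by simpa using h 0 (by simp)
  refine ContinuousLinearMap.opNorm_le_of_unit_norm hC fun x hx => ?_
  rw [Real.norm_eq_abs]
  refine abs_le'.mpr ⟨h x hx.le, ?_⟩
  rw [← map_neg]
  exact h (-x) (by rw [norm_neg, hx])

section SumNormDual

variable {E : Type} [NormedAddCommGroup E] [NormedSpace ℝ E] (S : Ell2 →L[ℝ] E)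

theorem abs_le_norm_of_norm_le_one {F : Type} [NormedAddCommGroup F] [NormedSpace ℝ F]
    (f : StrongDual ℝ F) {x : F} (hx : ‖x‖ ≤ 1) : |f x| ≤ ‖f‖ :=
  (f.le_opNorm x).trans (mul_le_of_le_one_right (norm_nonneg f) hx)

theorem norm_toCLM_add_le_one {b : E} {a : Ell2} (hb : ‖b‖ ≤ 1) (ha : ‖a‖ ≤ 1) :
    ‖(sumNorm S).toCLM (b + S a)‖ ≤ 1 :=
  gauge_sumBall_le S one_pos hb ha

/-- The supremum of a functional over a sum of two sets is the sum of the suprema. -/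
theorem norm_dual_sumNorm (hS : IsCompact (S '' Metric.closedBall (0 : Ell2) 1))
    (f : StrongDual ℝ (sumNorm S).Space) :
    ‖f‖ = ‖f.comp (sumNorm S).toCLM‖ + ‖f.comp ((sumNorm S).toCLM.comp S)‖ := by
  refine le_antisymm (opNorm_le_of_forall_closedBall_le f fun x hx => ?_) ?_
  · obtain ⟨b, a, hb, ha, hba⟩ := exists_repr_of_gauge_sumBall S hS ((sumNorm S).symmCLM x)
    have hb' : ‖b‖ ≤ 1 := hb.trans hx
    have ha' : ‖a‖ ≤ 1 := ha.trans hx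
    have h1 : f x = f.comp (sumNorm S).toCLM b + f.comp ((sumNorm S).toCLM.comp S) a := by
      rw [← (sumNorm S).toCLM_symmCLM x, hba, map_add, map_add]
      rfl
    rw [h1]
    exact add_le_add ((le_abs_self _).trans (abs_le_norm_of_norm_le_one _ hb'))
      ((le_abs_self _).trans (abs_le_norm_of_norm_le_one _ ha'))
  · rw [← le_sub_iff_add_le]
    refine opNorm_le_of_forall_closedBall_le _ fun b hb => ?_
    rw [le_sub_comm]
    refine opNorm_le_of_forall_closedBall_le _ fun a ha => ?_
    rw [le_sub_iff_add_le']
    have h1 := (le_abs_self _).trans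
      (abs_le_norm_of_norm_le_one f (norm_toCLM_add_le_one S hb ha))
    rwa [map_add, map_add] at h1

/-- Equality in the triangle inequality for the dual norm forces it for the summand `‖S* f‖`, where
`(ℓ₂)*` is strictly convex and `S*` is injective by `hd`. -/
theorem strictConvexSpace_dual_sumNorm (hS : IsCompact (S '' Metric.closedBall (0 : Ell2) 1))
    (hd : ∀ f : StrongDual ℝ E, f.comp S = 0 → f = 0) :
    StrictConvexSpace ℝ (StrongDual ℝ (sumNorm S).Space) := by
  refine StrictConvexSpace.of_norm_add fun f g hf hg hfg => ?_
  let J : StrongDual ℝ (sumNorm S).Space →ₗ[ℝ] StrongDual ℝ Ell2 :=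
    ((ContinuousLinearMap.compL ℝ Ell2 (sumNorm S).Space ℝ).flip
      ((sumNorm S).toCLM.comp S)).toLinearMap
  have hJ : Function.Injective J := by
    rw [← LinearMap.ker_eq_bot, LinearMap.ker_eq_bot']
    intro k hk
    have h1 := hd (k.comp (sumNorm S).toCLM) hk
    ext x
    exact DFunLike.congr_fun h1 ((sumNorm S).symmCLM x)
  rw [← hJ.sameRay_map_iff (f := J), sameRay_iff_norm_add, ← map_add]
  have h1 := norm_dual_sumNorm S hS f
  have h2 := norm_dual_sumNorm S hS g
  have h3 := norm_dual_sumNorm S hS (f + g)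
  change _ = _ + ‖J f‖ at h1
  change _ = _ + ‖J g‖ at h2
  change _ = _ + ‖J (f + g)‖ at h3
  refine le_antisymm ((congrArg norm (map_add J f g)).le.trans (norm_add_le _ _)) ?_
  have h4 := norm_add_le (f.comp (sumNorm S).toCLM) (g.comp (sumNorm S).toCLM)
  rw [← ContinuousLinearMap.add_comp] at h4
  linarith

theorem isNormAttaining_zero (E : Type) [NormedAddCommGroup E] [NormedSpace ℝ E] [Nontrivial E] :
    IsNormAttaining (0 : StrongDual ℝ E) := by
  obtain ⟨x, hx⟩ := exists_norm_eq E zero_le_one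
  exact ⟨x, hx, by simp⟩

theorem isNormAttaining_of_norm_le_one {E : Type} [NormedAddCommGroup E] [NormedSpace ℝ E]
    [Nontrivial E] (f : StrongDual ℝ E) {x : E} (hx : ‖x‖ ≤ 1) (h : ‖f‖ ≤ |f x|) :
    IsNormAttaining f := by
  by_cases hf : f = 0
  · rw [hf]
    exact isNormAttaining_zero E
  have h1 : |f x| ≤ ‖f‖ * ‖x‖ := f.le_opNorm x
  have h2 := norm_pos_iff.mpr hf
  exact ⟨x, le_antisymm hx (by nlinarith), le_antisymm (abs_le_norm_of_norm_le_one f hx) h⟩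

theorem exists_norm_le_one_dual_ell2 (g : StrongDual ℝ Ell2) : ∃ a, ‖a‖ ≤ 1 ∧ g a = ‖g‖ := by
  by_cases hg : g = 0
  · exact ⟨0, by simp, by simp [hg]⟩
  set w := (InnerProductSpace.toDual ℝ Ell2).symm g with hw
  have hwn : ‖w‖ = ‖g‖ := (InnerProductSpace.toDual ℝ Ell2).symm.norm_map g
  have hg0 := norm_ne_zero_iff.mpr hg
  refine ⟨‖g‖⁻¹ • w, ?_, ?_⟩
  · rw [norm_smul, norm_inv, norm_norm, hwn, inv_mul_cancel₀ hg0]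
  · rw [map_smul, ← InnerProductSpace.toDual_symm_apply (𝕜 := ℝ) (y := g), ← hw,
      real_inner_self_eq_norm_sq, hwn, smul_eq_mul]
    field_simp

/-- A functional attains its supremum over the sum exactly when it does so on both summands, and on
the `ℓ₂` part it always does. -/
theorem isNormAttaining_sumNorm_iff [Nontrivial E]
    (hS : IsCompact (S '' Metric.closedBall (0 : Ell2) 1))
    (f : StrongDual ℝ (sumNorm S).Space) :
    IsNormAttaining f ↔ IsNormAttaining (f.comp (sumNorm S).toCLM) := by
  have hN : Nontrivial (sumNorm S).Space := inferInstanceAs (Nontrivial E)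
  have hn := norm_dual_sumNorm S hS f
  constructor
  · rintro ⟨x, hx, hfx⟩
    obtain ⟨b, a, hb, ha, hba⟩ := exists_repr_of_gauge_sumBall S hS ((sumNorm S).symmCLM x)
    have hb' : ‖b‖ ≤ 1 := hb.trans hx.le
    have ha' : ‖a‖ ≤ 1 := ha.trans hx.le
    refine isNormAttaining_of_norm_le_one _ hb' ?_
    have h1 : f x = f.comp (sumNorm S).toCLM b + f.comp ((sumNorm S).toCLM.comp S) a := by
      rw [← (sumNorm S).toCLM_symmCLM x, hba, map_add, map_add]
      rfl
    have h2 := abs_add_le (f.comp (sumNorm S).toCLM b) (f.comp ((sumNorm S).toCLM.comp S) a)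
    have h3 := abs_le_norm_of_norm_le_one (f.comp ((sumNorm S).toCLM.comp S)) ha'
    rw [← h1, hfx] at h2
    linarith
  · rintro ⟨b, hb, hfb⟩
    obtain ⟨b', hb', hfb'⟩ : ∃ b', ‖b'‖ ≤ 1 ∧
        f.comp (sumNorm S).toCLM b' = ‖f.comp (sumNorm S).toCLM‖ := by
      rcases abs_choice (f.comp (sumNorm S).toCLM b) with h | h
      · exact ⟨b, hb.le, by rw [← hfb, h]⟩
      · exact ⟨-b, by rw [norm_neg, hb], by rw [map_neg, ← hfb, h]⟩
    obtain ⟨a, ha, hfa⟩ := exists_norm_le_one_dual_ell2 (f.comp ((sumNorm S).toCLM.comp S))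
    refine isNormAttaining_of_norm_le_one f (norm_toCLM_add_le_one S hb' ha) ?_
    rw [hn, ← hfa, ← hfb', map_add, map_add]
    exact le_abs_self _

end SumNormDual

/-! ### The space `c₀` and its dual -/

/-- The unit vectors of `c₀`. -/
def c0Single (n : ℕ) : C₀(ℕ, ℝ) where
  toFun := Pi.single n 1
  continuous_toFun := continuous_of_discreteTopology
  zero_at_infty' := by
    rw [Filter.cocompact_eq_cofinite, Nat.cofinite_eq_atTop]
    refine tendsto_const_nhds.congr' ?_
    filter_upwards [Filter.eventually_gt_atTop n] with k hk
    rw [Pi.single_eq_of_ne hk.ne']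

theorem c0Single_apply (n k : ℕ) : c0Single n k = if k = n then 1 else 0 :=
  Pi.single_apply n 1 k

theorem C0.norm_le_iff (x : C₀(ℕ, ℝ)) {C : ℝ} (hC : 0 ≤ C) : ‖x‖ ≤ C ↔ ∀ n, |x n| ≤ C := by
  rw [← ZeroAtInftyContinuousMap.norm_toBCF_eq_norm]
  exact BoundedContinuousFunction.norm_le hC

theorem C0.abs_apply_le (x : C₀(ℕ, ℝ)) (n : ℕ) : |x n| ≤ ‖x‖ :=
  (C0.norm_le_iff x (norm_nonneg x)).mp le_rfl n

theorem norm_c0Single (n : ℕ) : ‖c0Single n‖ = 1 := by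
  refine le_antisymm ((C0.norm_le_iff _ zero_le_one).mpr fun k => ?_) ?_
  · rw [c0Single_apply]
    split_ifs <;> simp
  · have := C0.abs_apply_le (c0Single n) n
    rwa [c0Single_apply, if_pos rfl, abs_one] at this

instance nontrivial_c0 : Nontrivial C₀(ℕ, ℝ) :=
  ⟨c0Single 0, 0, fun h => by simpa [norm_c0Single] using congrArg norm h⟩

theorem C0.sum_single_apply (s : Finset ℕ) (c : ℕ → ℝ) (k : ℕ) :
    (∑ n ∈ s, c n • c0Single n) k = if k ∈ s then c k else 0 := by
  classical
  induction s using Finset.induction_on with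
  | empty => simp
  | insert a s ha ih =>
    rw [Finset.sum_insert ha, ZeroAtInftyContinuousMap.add_apply, ih,
      ZeroAtInftyContinuousMap.smul_apply, c0Single_apply]
    by_cases hk : k = a
    · subst hk; simp [ha]
    · simp [hk]

theorem C0.tendsto_zero (x : C₀(ℕ, ℝ)) : Filter.Tendsto x Filter.atTop (nhds 0) := by
  have := ZeroAtInftyContinuousMapClass.zero_at_infty x
  rwa [Filter.cocompact_eq_cofinite, Nat.cofinite_eq_atTop] at this

theorem C0.hasSum_single (x : C₀(ℕ, ℝ)) : HasSum (fun n => x n • c0Single n) x := by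
  refine Metric.tendsto_atTop.mpr fun ε hε => ?_
  obtain ⟨N, hN⟩ := Metric.tendsto_atTop.mp (C0.tendsto_zero x) (ε / 2) (by positivity)
  refine ⟨Finset.range N, fun s hs => ?_⟩
  rw [dist_eq_norm]
  refine lt_of_le_of_lt ((C0.norm_le_iff _ (by positivity)).mpr fun k => ?_) (half_lt_self hε)
  rw [ZeroAtInftyContinuousMap.sub_apply, C0.sum_single_apply]
  split_ifs with hk
  · simp only [sub_self, abs_zero]
    positivity
  · have h1 : N ≤ k := by
      by_contra! h
      exact hk (hs (Finset.mem_range.mpr h))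
    have h2 := hN k h1
    rw [Real.dist_eq, sub_zero] at h2
    rw [zero_sub, abs_neg]
    exact h2.le

/-- Finite sums of unit vectors with coefficients in `{-1, 0, 1}` lie in the unit ball, so `‖f‖`
bounds the partial sums. -/
theorem C0.summable_dual (f : StrongDual ℝ C₀(ℕ, ℝ)) : Summable fun n => ‖f (c0Single n)‖ := by
  refine summable_of_sum_le (c := ‖f‖) (fun _ => norm_nonneg _) fun s => ?_
  have h1 : ∑ n ∈ s, ‖f (c0Single n)‖ =
      f (∑ n ∈ s, (SignType.sign (f (c0Single n)) : ℝ) • c0Single n) := by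
    rw [map_sum]
    refine Finset.sum_congr rfl fun n _ => ?_
    rw [map_smul, smul_eq_mul, Real.norm_eq_abs, sign_mul_self]
  rw [h1]
  refine (le_abs_self _).trans (abs_le_norm_of_norm_le_one f ?_)
  refine (C0.norm_le_iff _ zero_le_one).mpr fun k => ?_
  rw [C0.sum_single_apply]
  split_ifs
  · rcases SignType.sign (f (c0Single k)) with _ | _ | _ <;> simp
  · simp

theorem C0.dual_eq_zero (f : StrongDual ℝ C₀(ℕ, ℝ)) (h : ∀ n, f (c0Single n) = 0) : f = 0 := by
  ext x
  have h1 := (C0.hasSum_single x).mapL f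
  simp only [map_smul, h, smul_zero] at h1
  exact h1.unique hasSum_zero

/-- A norm-attaining functional on `c₀` has finite support. -/
theorem IsNormAttaining.eventually_eq_zero {f : StrongDual ℝ C₀(ℕ, ℝ)} (hf : IsNormAttaining f) :
    ∃ N, ∀ n, N ≤ n → f (c0Single n) = 0 := by
  obtain ⟨x, hx, hfx⟩ := hf
  obtain ⟨N, hN⟩ := Metric.tendsto_atTop.mp (C0.tendsto_zero x) (1 / 2) (by norm_num)
  refine ⟨N, fun n hn => ?_⟩
  -- Beyond `N` the entries of `x` are below `1/2`, so `x ± e_n / 2` stays in the ball; maximality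
  -- of `|f x|` then forces `f e_n = 0`.
  have hb : ∀ t : ℝ, |t| ≤ 1 / 2 → ‖x + t • c0Single n‖ ≤ 1 := fun t ht => by
    refine (C0.norm_le_iff _ zero_le_one).mpr fun k => ?_
    rw [ZeroAtInftyContinuousMap.add_apply, ZeroAtInftyContinuousMap.smul_apply, c0Single_apply]
    split_ifs with hk
    · have h1 := hN k (hk ▸ hn)
      rw [Real.dist_eq, sub_zero] at h1
      rw [smul_eq_mul, mul_one]
      exact (abs_add_le _ _).trans (by linarith)
    · rw [smul_zero, add_zero]
      exact (C0.abs_apply_le x k).trans hx.le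
  have h1 := abs_le_norm_of_norm_le_one f (hb (1 / 2) (by norm_num [abs_of_pos]))
  have h2 := abs_le_norm_of_norm_le_one f (hb (-(1 / 2)) (by norm_num [abs_of_pos]))
  rw [← hfx, map_add, map_smul, smul_eq_mul] at h1 h2
  rcases abs_cases (f x) with ⟨h3, h4⟩ | ⟨h3, h4⟩ <;> rw [h3, abs_le] at h1 h2 <;> linarith

/-- The sequence `2^{-n}`. -/
def geomEll1 : Ell1 :=
  ⟨fun n => 1 / 2 ^ (n + 1), memℓp_one_iff.mpr Choices.summable_geom.norm⟩

/-- The operator `ℓ₂ → c₀`, `a ↦ (2^{-n} a_n)_n`. -/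
def c0Op : Ell2 →L[ℝ] C₀(ℕ, ℝ) :=
  (ell1Lift c0Single ⟨1, fun n => (norm_c0Single n).le⟩).comp (diagOp geomEll1)

theorem isCompact_c0Op_image : IsCompact (c0Op '' Metric.closedBall (0 : Ell2) 1) := by
  have h := (isCompact_diagOp_image geomEll1).image
    (ell1Lift c0Single ⟨1, fun n => (norm_c0Single n).le⟩).continuous
  rwa [← Set.image_comp] at h

/-- The range contains every unit vector, so the adjoint is injective. -/
theorem c0Op_single (n : ℕ) : c0Op (lp.single 2 n (2 ^ (n + 1))) = c0Single n := by
  rw [c0Op, ContinuousLinearMap.comp_apply, diagOp_single]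
  have : geomEll1 n * 2 ^ (n + 1) = 1 := by
    change (1 / 2 ^ (n + 1) : ℝ) * 2 ^ (n + 1) = 1
    field_simp
  rw [this, ell1Lift_single]

theorem eq_zero_of_comp_c0Op (f : StrongDual ℝ C₀(ℕ, ℝ)) (hf : f.comp c0Op = 0) : f = 0 :=
  C0.dual_eq_zero f fun n => by
    rw [← c0Op_single]
    exact DFunLike.congr_fun hf _

/-- The smooth equivalent norm on `c₀` with unit ball `B_{c₀} + S(B_{ℓ₂})`. -/
def smoothNorm : EquivNorm C₀(ℕ, ℝ) := sumNorm c0Op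

theorem isSmoothSpace_smoothNorm : IsSmoothSpace smoothNorm.Space :=
  have : StrictConvexSpace ℝ (StrongDual ℝ smoothNorm.Space) :=
    strictConvexSpace_dual_sumNorm c0Op isCompact_c0Op_image
      eq_zero_of_comp_c0Op
  isSmoothSpace_of_strictConvexSpace_dual _

theorem isNormAttaining_smoothNorm_iff (f : StrongDual ℝ smoothNorm.Space) :
    IsNormAttaining f ↔ IsNormAttaining (f.comp smoothNorm.toCLM) :=
  isNormAttaining_sumNorm_iff c0Op isCompact_c0Op_image f

/-! ### A dense operator range which meets the norm-attaining functionals only in `0` -/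

/-- A bounded sequence is zero if its power series vanishes at the points `2^{-(n+1)}`, `n ≥ N`. -/
theorem eq_zero_of_hasSum_pow {a : ℕ → ℝ} {C : ℝ} (ha : ∀ k, |a k| ≤ C) {N : ℕ}
    (h : ∀ n, N ≤ n → HasSum (fun k => a k * (1 / 2 : ℝ) ^ ((n + 1) * (k + 1))) 0) :
    ∀ k, a k = 0 := by
  intro k
  induction k using Nat.strong_induction_on with
  | _ k ih =>
    have hC : 0 ≤ C := (abs_nonneg _).trans (ha 0)
    -- With the earlier coefficients zero, the `k`-th term equals minus the tail, a geometric series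
    -- one order smaller in `r = 2^{-(n+1)}`.
    have bound : ∀ n, N ≤ n → |a k| ≤ 2 * C * (1 / 2 : ℝ) ^ (n + 1) := fun n hn => by
      set r : ℝ := (1 / 2) ^ (n + 1) with hr
      have hr0 : 0 < r := by positivity
      have hr1 : r ≤ 1 / 2 := by
        rw [hr, pow_succ]
        have : (1 / 2 : ℝ) ^ n ≤ 1 := pow_le_one₀ (by norm_num) (by norm_num)
        linarith
      have h1 := h n hn
      simp only [pow_mul, ← hr] at h1
      have h2 := (hasSum_nat_add_iff' (k + 1)).mpr h1
      have h3 : ∑ i ∈ Finset.range (k + 1), a i * r ^ (i + 1) = a k * r ^ (k + 1) := by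
        rw [Finset.sum_range_succ, Finset.sum_eq_zero, zero_add]
        intro i hi
        rw [ih i (Finset.mem_range.mp hi), zero_mul]
      rw [h3, zero_sub] at h2
      have h4 : HasSum (fun i : ℕ => C * r ^ (k + 2) * r ^ i) (C * r ^ (k + 2) * (1 - r)⁻¹) :=
        (hasSum_geometric_of_lt_one hr0.le (by linarith)).mul_left _
      have h5 : ‖-(a k * r ^ (k + 1))‖ ≤ C * r ^ (k + 2) * (1 - r)⁻¹ := by
        rw [← h2.tsum_eq]
        refine tsum_of_norm_bounded h4 fun i => ?_
        rw [norm_mul, norm_pow, Real.norm_of_nonneg hr0.le,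
          show i + (k + 1) + 1 = (k + 2) + i by ring, pow_add, ← mul_assoc]
        gcongr
        exact ha _
      rw [norm_neg, norm_mul, norm_pow, Real.norm_of_nonneg hr0.le, Real.norm_eq_abs] at h5
      have h6 : (1 - r)⁻¹ ≤ 2 := by
        rw [inv_le_comm₀ (by linarith) (by norm_num)]
        linarith
      have h7 : C * r ^ (k + 2) * (1 - r)⁻¹ ≤ C * r ^ (k + 2) * 2 := by gcongr
      have h8 : |a k| * r ^ (k + 1) ≤ 2 * C * r * r ^ (k + 1) := by
        refine (h5.trans h7).trans (le_of_eq ?_)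
        ring
      exact le_of_mul_le_mul_right h8 (by positivity)
    have hlim : Filter.Tendsto (fun n : ℕ => 2 * C * (1 / 2 : ℝ) ^ (n + 1)) Filter.atTop
        (nhds (2 * C * 0)) :=
      ((Filter.tendsto_add_atTop_iff_nat 1).mpr (tendsto_pow_atTop_nhds_zero_of_lt_one
        (by norm_num) (by norm_num))).const_mul _
    rw [mul_zero] at hlim
    have h0 := ge_of_tendsto hlim (Filter.eventually_atTop.mpr ⟨N, bound⟩)
    exact abs_eq_zero.mp (le_antisymm h0 (abs_nonneg _))

theorem pow_half_le (n k : ℕ) : (1 / 2 : ℝ) ^ ((n + 1) * (k + 1)) ≤ 1 / 2 ^ (n + 1) := by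
  rw [← one_div_pow]
  exact pow_le_pow_of_le_one (by norm_num) (by norm_num) (Nat.le_mul_of_pos_right _ (by omega))

/-- The sequence `(2^{-(n+1)(k+1)})_n` in `ℓ₁`. -/
def powCol (k : ℕ) : Ell1 :=
  ⟨fun n => (1 / 2 : ℝ) ^ ((n + 1) * (k + 1)), memℓp_one_iff.mpr
    (Summable.of_nonneg_of_le (fun _ => norm_nonneg _) (fun n => by
      rw [Real.norm_of_nonneg (by positivity)]
      exact pow_half_le n k) Choices.summable_geom)⟩

theorem powCol_apply (k n : ℕ) : powCol k n = (1 / 2 : ℝ) ^ ((n + 1) * (k + 1)) := rfl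

theorem norm_powCol_le (k : ℕ) : ‖powCol k‖ ≤ 1 := by
  rw [Ell1.norm_eq, ← Choices.tsum_geom]
  refine Summable.tsum_le_tsum (fun n => ?_) (memℓp_one_iff.mp (lp.memℓp (powCol k)))
    Choices.summable_geom
  rw [powCol_apply, Real.norm_of_nonneg (by positivity)]
  exact pow_half_le n k

theorem HasSum.dual_apply {ι V : Type} [NormedAddCommGroup V] [NormedSpace ℝ V]
    {g : ι → StrongDual ℝ V} {f : StrongDual ℝ V} (h : HasSum g f) (x : V) :
    HasSum (fun i => g i x) (f x) :=
  h.mapL (ContinuousLinearMap.apply ℝ ℝ x)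

theorem dense_of_forall_dual_eq_zero {F : Type} [NormedAddCommGroup F] [NormedSpace ℝ F]
    (Y : Submodule ℝ F) (h : ∀ z : StrongDual ℝ F, (∀ y ∈ Y, z y = 0) → z = 0) :
    Dense (Y : Set F) := by
  intro f
  by_contra hf
  obtain ⟨g, u, hgu, huf⟩ := geometric_hahn_banach_closed_point
    (s := closure (Y : Set F)) (x := f) Y.convex.closure isClosed_closure hf
  have hg : ∀ y ∈ Y, g y = 0 := fun y hy => by
    by_contra hy0
    have h1 := hgu _ (subset_closure (Y.smul_mem ((u + 1) / g y) hy))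
    rw [map_smul, smul_eq_mul, div_mul_cancel₀ _ hy0] at h1
    linarith
  have h2 := hgu 0 (subset_closure Y.zero_mem)
  rw [h g hg] at h2 huf
  simp only [zero_apply] at h2 huf
  linarith

section OperatorRange

variable (q : EquivNorm C₀(ℕ, ℝ))

/-- The coordinate functionals on a renorming of `c₀`. -/
def coord (n : ℕ) : StrongDual ℝ q.Space :=
  (LinearMap.mkContinuous
    { toFun := fun x : C₀(ℕ, ℝ) => x n
      map_add' := fun _ _ => rfl
      map_smul' := fun _ _ => rfl } 1 fun x => by
    rw [one_mul]
    exact C0.abs_apply_le x n).comp q.symmCLM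

theorem norm_coord_le (n : ℕ) : ‖coord q n‖ ≤ ‖q.symmCLM‖ :=
  ContinuousLinearMap.opNorm_le_bound _ (norm_nonneg _) fun x =>
    (C0.abs_apply_le _ n).trans (q.symmCLM.le_opNorm x)

/-- The coefficients are absolutely summable, so the expansion converges in norm and functionals on
the dual are determined by their values on the coordinates. -/
theorem hasSum_coord (f : StrongDual ℝ q.Space) :
    HasSum (fun n => f (q.toCLM (c0Single n)) • coord q n) f := by
  have hs : Summable fun n => f (q.toCLM (c0Single n)) • coord q n :=
    Summable.of_norm_bounded ((C0.summable_dual (f.comp q.toCLM)).mul_right ‖q.symmCLM‖)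
      fun n => by
        rw [norm_smul]
        exact mul_le_mul_of_nonneg_left (norm_coord_le q n) (norm_nonneg _)
  have key : f = ∑' n, f (q.toCLM (c0Single n)) • coord q n := by
    ext x
    have h1 := (C0.hasSum_single (q.symmCLM x)).mapL (f.comp q.toCLM)
    refine HasSum.unique (f := fun n => q.symmCLM x n * f (q.toCLM (c0Single n))) ?_
      ((hs.hasSum.dual_apply x).congr_fun fun n => mul_comm _ _)
    refine h1.congr_fun fun n => ?_
    rw [map_smul]
    rfl
  nth_rw 2 [key]
  exact hs.hasSum

/-- The operator on `ℓ₁` with matrix `2^{-(n+1)(k+1)}`. -/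
def powOp : Ell1 →L[ℝ] Ell1 := ell1Lift powCol ⟨1, norm_powCol_le⟩

theorem hasSum_powOp (a : Ell1) (n : ℕ) :
    HasSum (fun k => a k * (1 / 2 : ℝ) ^ ((n + 1) * (k + 1))) (powOp a n) :=
  (hasSum_ell1Lift powCol ⟨1, norm_powCol_le⟩ a).mapL (lp.evalCLM ℝ (fun _ : ℕ => ℝ) 1 n)

/-- Coordinate `n` of `powOp a` is the value at `2^{-(n+1)}` of the power series with coefficients
`a`. -/
theorem eq_zero_of_powOp_eventually {a : Ell1} {N : ℕ} (h : ∀ n, N ≤ n → powOp a n = 0) :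
    a = 0 := by
  refine lp.ext (funext fun k => ?_)
  refine eq_zero_of_hasSum_pow (a := a) (C := ‖a‖)
    (fun k => lp.norm_apply_le_norm (by simp) a k) (N := N) (fun n hn => ?_) k
  rw [← h n hn]
  exact hasSum_powOp a n

/-- The identification of `ℓ₁` with the dual of a renorming of `c₀`. -/
def ell1ToDual : Ell1 →L[ℝ] StrongDual ℝ q.Space :=
  ell1Lift (coord q) ⟨‖q.symmCLM‖, norm_coord_le q⟩

theorem ell1ToDual_single (a : Ell1) (n : ℕ) :
    ell1ToDual q a (q.toCLM (c0Single n)) = a n := by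
  have h := (hasSum_ell1Lift (coord q) ⟨‖q.symmCLM‖, norm_coord_le q⟩ a).dual_apply
    (q.toCLM (c0Single n))
  refine h.unique ?_
  have h1 := hasSum_single (f := fun k => a k * c0Single n k) n fun k hk => by
    rw [c0Single_apply, if_neg hk, mul_zero]
  rw [c0Single_apply, if_pos rfl, mul_one] at h1
  exact h1

/-- An injective operator from `ℓ₁` to the dual of a renorming of `c₀` with dense range which
contains no nonzero functional of finite support. -/
def rangeOp : Ell1 →L[ℝ] StrongDual ℝ q.Space := (ell1ToDual q).comp powOp

theorem rangeOp_single (a : Ell1) (n : ℕ) : rangeOp q a (q.toCLM (c0Single n)) = powOp a n :=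
  ell1ToDual_single q (powOp a) n

theorem rangeOp_injective : Function.Injective (rangeOp q) := by
  rw [injective_iff_map_eq_zero]
  intro a ha
  refine eq_zero_of_powOp_eventually (N := 0) fun n _ => ?_
  rw [← rangeOp_single q, ha, zero_apply]

theorem eq_zero_of_isNormAttaining_rangeOp (a : Ell1)
    (h : IsNormAttaining ((rangeOp q a).comp q.toCLM)) : a = 0 := by
  obtain ⟨N, hN⟩ := h.eventually_eq_zero
  refine eq_zero_of_powOp_eventually (N := N) fun n hn => ?_
  rw [← rangeOp_single q]
  exact hN n hn

theorem hasSum_rangeOp_single (k : ℕ) : HasSum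
    (fun n => (1 / 2 : ℝ) ^ ((n + 1) * (k + 1)) • coord q n)
    (rangeOp q (lp.single 1 k 1)) := by
  rw [rangeOp, ContinuousLinearMap.comp_apply, powOp, ell1Lift_single]
  exact hasSum_ell1Lift (coord q) ⟨‖q.symmCLM‖, norm_coord_le q⟩ (powCol k)

/-- The matrix is symmetric: if `z` annihilates the range, the power series with bounded
coefficients `z (coord q n)` vanishes at all points `2^{-(k+1)}`. -/
theorem dense_range_rangeOp :
    Dense (LinearMap.range (rangeOp q).toLinearMap : Set (StrongDual ℝ q.Space)) := by
  refine dense_of_forall_dual_eq_zero _ fun z hz => ?_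
  have h1 : ∀ n, z (coord q n) = 0 := by
    refine eq_zero_of_hasSum_pow (C := ‖z‖ * ‖q.symmCLM‖) (N := 0) (fun n => ?_) fun k _ => ?_
    · exact (z.le_opNorm _).trans (mul_le_mul_of_nonneg_left (norm_coord_le q n) (norm_nonneg z))
    · have h2 := (hasSum_rangeOp_single q k).mapL z
      rw [show z (rangeOp q (lp.single 1 k 1)) = 0 from hz _ ⟨_, rfl⟩] at h2
      refine h2.congr_fun fun n => ?_
      rw [map_smul, smul_eq_mul, mul_comm (n + 1), mul_comm]
  ext f
  refine ((hasSum_coord q f).mapL z).unique (hasSum_zero.congr_fun fun n => ?_)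
  rw [map_smul, h1, smul_zero]

theorem not_finiteDimensional_ell1 : ¬ FiniteDimensional ℝ Ell1 := by
  intro h
  have hli : LinearIndependent ℝ fun n : ℕ => (lp.single 1 n (1 : ℝ) : Ell1) := by
    rw [linearIndependent_iff']
    intro s g hg i hi
    have h1 := congrArg (lp.evalCLM ℝ (fun _ : ℕ => ℝ) 1 i) hg
    rw [map_sum, map_zero, Finset.sum_eq_single_of_mem i hi] at h1
    · rw [map_smul] at h1
      change g i * (lp.single 1 i (1 : ℝ) : Ell1) i = 0 at h1
      rwa [lp.single_apply_self, mul_one] at h1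
    · intro j _ hj
      rw [map_smul]
      change g j * (lp.single 1 j (1 : ℝ) : Ell1) i = 0
      rw [lp.single_apply_ne _ _ _ hj.symm, mul_zero]
  exact not_finite_iff_infinite.mpr inferInstance (hli.finite (R := ℝ))

end OperatorRange

/-! ### An injective operator on `ℓ₁` with prescribed dense directions -/

/-- The rapidly decreasing weights `2^{-(i²+i)}`. -/
def fastWeight (i : ℕ) : ℝ := (1 / 2) ^ (i ^ 2 + i)

theorem fastWeight_pos (i : ℕ) : 0 < fastWeight i := by
  unfold fastWeight
  positivity

/-- Summed over `l`, the weights after `j` amount to at most half of `fastWeight j * 2^{-j}`, the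
size of the `j`-th perturbation. -/
theorem fastWeight_add_le (j l : ℕ) :
    fastWeight (l + (j + 1)) ≤ fastWeight j * (1 / 2) ^ j * (1 / 4) * (1 / 2) ^ l := by
  have h : fastWeight j * (1 / 2) ^ j * (1 / 4) * (1 / 2) ^ l =
      (1 / 2) ^ (j ^ 2 + j + j + 2 + l) := by
    unfold fastWeight
    rw [pow_add (1 / 2 : ℝ) (j ^ 2 + j + j + 2), pow_add (1 / 2 : ℝ) (j ^ 2 + j + j),
      pow_add (1 / 2 : ℝ) (j ^ 2 + j)]
    norm_num
  rw [h]
  exact pow_le_pow_of_le_one (by norm_num) (by norm_num) (by nlinarith [Nat.zero_le (j * l)])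

theorem fastWeight_le_one (i : ℕ) : fastWeight i ≤ 1 := pow_le_one₀ (by norm_num) (by norm_num)

/-- Rapidly decreasing perturbations of vectors `d_i` supported in `[0, i)` are `ℓ_∞`-independent. -/
theorem eq_zero_of_hasSum_perturbed {d : ℕ → Ell1} (hd : ∀ i, ‖d i‖ ≤ 1)
    (hsupp : ∀ i j, i ≤ j → d i j = 0) {b : ℕ → ℝ} {C : ℝ} (hb : ∀ i, |b i| ≤ C)
    (h : HasSum (fun i => b i • fastWeight i • (d i + (1 / 2 : ℝ) ^ i • (lp.single 1 i 1 : Ell1)))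
      0) : ∀ i, b i = 0 := by
  have hcoord : ∀ j, HasSum (fun i => b i * (fastWeight i * (d i j + (1 / 2 : ℝ) ^ i *
      (lp.single 1 i (1 : ℝ) : Ell1) j))) 0 := fun j =>
    h.mapL (lp.evalCLM ℝ (fun _ : ℕ => ℝ) 1 j)
  -- In coordinate `j` the terms `i < j` vanish, the term `i = j` contributes only its perturbation,
  -- and the tail is at most half as large relative to `C`. Any uniform bound on `b` can thus be
  -- halved.
  have step : ∀ C, (∀ i, |b i| ≤ C) → ∀ i, |b i| ≤ C / 2 := fun C hb j => by
    have hC : 0 ≤ C := (abs_nonneg _).trans (hb 0)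
    have h1 := (hasSum_nat_add_iff' (j + 1)).mpr (hcoord j)
    have h2 : ∑ i ∈ Finset.range (j + 1), b i * (fastWeight i * (d i j + (1 / 2 : ℝ) ^ i *
        (lp.single 1 i (1 : ℝ) : Ell1) j)) = b j * (fastWeight j * (1 / 2) ^ j) := by
      rw [Finset.sum_range_succ, Finset.sum_eq_zero, zero_add, hsupp j j le_rfl,
        lp.single_apply_self, zero_add, mul_one]
      intro i hi
      have hij := Finset.mem_range.mp hi
      rw [hsupp i j hij.le, lp.single_apply_ne _ _ _ hij.ne', mul_zero, add_zero, mul_zero,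
        mul_zero]
    rw [h2, zero_sub] at h1
    have h3 : HasSum (fun l : ℕ => C * (fastWeight j * (1 / 2) ^ j * (1 / 4)) * (1 / 2 : ℝ) ^ l)
        (C * (fastWeight j * (1 / 2) ^ j * (1 / 4)) * 2) := hasSum_geometric_two.mul_left _
    have h4 : ‖-(b j * (fastWeight j * (1 / 2) ^ j))‖ ≤
        C * (fastWeight j * (1 / 2) ^ j * (1 / 4)) * 2 := by
      rw [← h1.tsum_eq]
      refine tsum_of_norm_bounded h3 fun l => ?_
      rw [lp.single_apply_ne _ _ _ (show j ≠ l + (j + 1) by omega), mul_zero, add_zero, norm_mul,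
        norm_mul, Real.norm_of_nonneg (fastWeight_pos _).le, mul_assoc]
      refine mul_le_mul (hb _) ?_ (mul_nonneg (fastWeight_pos _).le (norm_nonneg _)) hC
      refine le_trans ?_ (fastWeight_add_le j l)
      refine mul_le_of_le_one_right (fastWeight_pos _).le ?_
      exact (lp.norm_apply_le_norm (by simp) _ _).trans (hd _)
    have hpos : 0 < fastWeight j * (1 / 2) ^ j := mul_pos (fastWeight_pos j) (by positivity)
    rw [norm_neg, norm_mul, Real.norm_of_nonneg hpos.le, Real.norm_eq_abs] at h4
    refine le_of_mul_le_mul_right (h4.trans (le_of_eq ?_)) hpos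
    ring
  have iter : ∀ k i, |b i| ≤ C * (1 / 2) ^ k := fun k => by
    induction k with
    | zero => simpa using hb
    | succ k ih =>
      intro i
      rw [pow_succ]
      linarith [step _ ih i]
  intro i
  have hlim : Filter.Tendsto (fun k : ℕ => C * (1 / 2 : ℝ) ^ k) Filter.atTop (nhds (C * 0)) :=
    (tendsto_pow_atTop_nhds_zero_of_lt_one (by norm_num) (by norm_num)).const_mul _
  rw [mul_zero] at hlim
  exact abs_eq_zero.mp (le_antisymm (ge_of_tendsto' hlim fun k => iter k i) (abs_nonneg _))

/-- Truncation of a sequence to `[0, i)`. -/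
def truncate (i : ℕ) (g : Ell1) : Ell1 := ∑ k ∈ Finset.range i, lp.single 1 k (g k)

theorem truncate_apply (g : Ell1) {i j : ℕ} (h : i ≤ j) : truncate i g j = 0 := by
  rw [truncate, lp.coeFn_sum, Finset.sum_apply]
  refine Finset.sum_eq_zero fun k hk => ?_
  have := Finset.mem_range.mp hk
  rw [lp.single_apply_ne _ _ _ (by omega)]

theorem tendsto_truncate (g : Ell1) :
    Filter.Tendsto (fun i => truncate i g) Filter.atTop (nhds g) :=
  (lp.hasSum_single (E := fun _ : ℕ => ℝ) (p := 1) (by simp) g).tendsto_sum_nat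

/-- The truncated and scaled vectors of a dense sequence in which every term recurs. -/
def truncDir (i : ℕ) : Ell1 :=
  -- For `i = pair (pair j l) m` only `j` selects the vector, so it recurs for every `m` and
  -- infinitely many `l`. The scaling keeps norms at most one without dividing by zero.
  (1 + ‖truncate i (TopologicalSpace.denseSeq Ell1 i.unpair.1.unpair.1)‖)⁻¹ •
    truncate i (TopologicalSpace.denseSeq Ell1 i.unpair.1.unpair.1)

theorem norm_truncDir_le (i : ℕ) : ‖truncDir i‖ ≤ 1 := by
  have h : 0 < 1 + ‖truncate i (TopologicalSpace.denseSeq Ell1 i.unpair.1.unpair.1)‖ := by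
    positivity
  rw [truncDir, norm_smul, norm_inv, Real.norm_of_nonneg h.le, inv_mul_le_one₀ h]
  linarith

theorem truncDir_apply (i j : ℕ) (h : i ≤ j) : truncDir i j = 0 := by
  rw [truncDir, lp.coeFn_smul, Pi.smul_apply, truncate_apply _ h, smul_zero]

/-- The directions `d_i + 2^{-i} e_i`. -/
def perturbedDir (i : ℕ) : Ell1 := truncDir i + (1 / 2 : ℝ) ^ i • (lp.single 1 i 1 : Ell1)

theorem norm_perturbedDir_le (i : ℕ) : ‖perturbedDir i‖ ≤ 2 := by
  refine (norm_add_le _ _).trans ?_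
  have h1 : ‖(1 / 2 : ℝ) ^ i • (lp.single 1 i 1 : Ell1)‖ ≤ 1 := by
    rw [norm_smul, lp.norm_single (by simp), norm_one, mul_one, Real.norm_of_nonneg (by positivity)]
    exact pow_le_one₀ (by norm_num) (by norm_num)
  linarith [norm_truncDir_le i]

/-- As `l` grows so does the index, hence the truncation becomes exact in the limit and the
perturbation disappears. -/
theorem tendsto_perturbedDir (j m : ℕ) :
    Filter.Tendsto (fun l => perturbedDir (Nat.pair (Nat.pair j l) m)) Filter.atTop
      (nhds ((1 + ‖TopologicalSpace.denseSeq Ell1 j‖)⁻¹ • TopologicalSpace.denseSeq Ell1 j)) := by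
  have hi : Filter.Tendsto (fun l => Nat.pair (Nat.pair j l) m) Filter.atTop Filter.atTop :=
    Filter.tendsto_atTop_mono
      (fun l => (Nat.right_le_pair j l).trans (Nat.left_le_pair _ m)) Filter.tendsto_id
  have h1 := (tendsto_truncate (TopologicalSpace.denseSeq Ell1 j)).comp hi
  have h2 : Filter.Tendsto (fun l => truncDir (Nat.pair (Nat.pair j l) m)) Filter.atTop
      (nhds ((1 + ‖TopologicalSpace.denseSeq Ell1 j‖)⁻¹ • TopologicalSpace.denseSeq Ell1 j)) := by
    simp only [truncDir, Nat.unpair_pair]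
    exact ((h1.norm.const_add 1).inv₀ (by positivity)).smul h1
  have h3 : Filter.Tendsto (fun i : ℕ => (1 / 2 : ℝ) ^ i • (lp.single 1 i 1 : Ell1)) Filter.atTop
      (nhds 0) := by
    rw [tendsto_zero_iff_norm_tendsto_zero]
    refine (tendsto_pow_atTop_nhds_zero_of_lt_one (r := (1 / 2 : ℝ)) (by norm_num)
      (by norm_num)).congr fun i => ?_
    rw [norm_smul, lp.norm_single (by simp), norm_one, mul_one, Real.norm_of_nonneg (by positivity)]
  have h4 := h2.add (h3.comp hi)
  rw [add_zero] at h4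
  exact h4

/-- The operator mapping `e_{n,m}` to a positive multiple of the direction with index `(n, m)`. -/
def dirOp : Ell1Prod →L[ℝ] Ell1 :=
  ell1Lift (fun i : ℕ × ℕ => fastWeight (Nat.pair i.1 i.2) • perturbedDir (Nat.pair i.1 i.2))
    ⟨2, fun i => by
      rw [norm_smul, Real.norm_of_nonneg (fastWeight_pos _).le]
      exact (mul_le_of_le_one_left (norm_nonneg _) (fastWeight_le_one _)).trans
        (norm_perturbedDir_le _)⟩

theorem dirOp_single (n m : ℕ) : dirOp (lp.single 1 (n, m) 1) =
    fastWeight (Nat.pair n m) • perturbedDir (Nat.pair n m) := by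
  rw [dirOp, ell1Lift_single]

/-- After reindexing by the pairing bijection, a kernel element is a bounded coefficient sequence as
in `eq_zero_of_hasSum_perturbed`. -/
theorem dirOp_injective : Function.Injective dirOp := by
  rw [injective_iff_map_eq_zero]
  intro a ha
  have h : HasSum _ (dirOp a) := hasSum_ell1Lift _ _ a
  rw [ha, ← Nat.pairEquiv.symm.hasSum_iff] at h
  have h1 := eq_zero_of_hasSum_perturbed norm_truncDir_le truncDir_apply
    (b := fun i => a (Nat.unpair i)) (C := ‖a‖)
    (fun i => lp.norm_apply_le_norm (by simp) a _) (h.congr_fun fun i => by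
      change _ = a (Nat.unpair i) • fastWeight (Nat.pair (Nat.unpair i).1 (Nat.unpair i).2) •
        perturbedDir (Nat.pair (Nat.unpair i).1 (Nat.unpair i).2)
      rw [Nat.pair_unpair]
      rfl)
  refine lp.ext (funext fun i => ?_)
  have := h1 (Nat.pair i.1 i.2)
  simp only [Nat.unpair_pair] at this
  exact this

theorem continuousAt_normalize {E : Type} [NormedAddCommGroup E] [NormedSpace ℝ E] {x : E}
    (hx : x ≠ 0) : ContinuousAt NormedSpace.normalize x :=
  (continuousAt_id.norm.inv₀ (norm_ne_zero_iff.mpr hx)).smul continuousAt_id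

/-- Normalization ignores the positive weights, so the images of the unit vectors for a fixed `m`
approach every direction from the dense sequence. -/
theorem normalize_apply_mem_closure {F : Type} [NormedAddCommGroup F] [NormedSpace ℝ F]
    (A : Ell1 →L[ℝ] F) (hA : Function.Injective A) (m : ℕ) {h : Ell1} (hh : h ≠ 0) :
    NormedSpace.normalize (A h) ∈
      closure (Set.range fun n : ℕ => NormedSpace.normalize (A (dirOp (lp.single 1 (n, m) 1)))) := by
  have hne : ∀ x : Ell1, x ≠ 0 → A x ≠ 0 := fun x hx h0 => hx (hA (h0.trans (map_zero A).symm))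
  have hdense : ∀ j, TopologicalSpace.denseSeq Ell1 j ≠ 0 →
      NormedSpace.normalize (A (TopologicalSpace.denseSeq Ell1 j)) ∈
        closure (Set.range fun n : ℕ => NormedSpace.normalize (A (dirOp (lp.single 1 (n, m) 1)))) :=
    fun j hj => by
      have hc : 0 < (1 + ‖TopologicalSpace.denseSeq Ell1 j‖)⁻¹ := by positivity
      have h1 : A ((1 + ‖TopologicalSpace.denseSeq Ell1 j‖)⁻¹ •
          TopologicalSpace.denseSeq Ell1 j) ≠ 0 := hne _ (smul_ne_zero hc.ne' hj)
      have h2 := (continuousAt_normalize h1).tendsto.comp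
        ((A.continuous.tendsto _).comp (tendsto_perturbedDir j m))
      rw [map_smul, NormedSpace.normalize_smul_of_pos hc] at h2
      refine mem_closure_of_tendsto h2 (Filter.Eventually.of_forall fun l => ⟨Nat.pair j l, ?_⟩)
      simp only [Function.comp_apply, dirOp_single, map_smul]
      rw [NormedSpace.normalize_smul_of_pos (fastWeight_pos _)]
  -- Zero is removed from the dense sequence because `hdense` covers only its nonzero terms.
  have h3 : h ∈ closure (Set.range (TopologicalSpace.denseSeq Ell1) ∩ {0}ᶜ) :=
    ((TopologicalSpace.denseRange_denseSeq Ell1).open_subset_closure_inter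
      isOpen_compl_singleton |>.trans (by rw [Set.inter_comm])) hh
  have h4 : ContinuousAt (fun x => NormedSpace.normalize (A x)) h :=
    (continuousAt_normalize (hne h hh)).comp A.continuous.continuousAt
  have h5 := h4.continuousWithinAt.mem_closure_image h3
  refine closure_minimal ?_ isClosed_closure h5
  rintro _ ⟨_, ⟨⟨j, rfl⟩, hj⟩, rfl⟩
  exact hdense j hj

theorem exists_dense_directions {F : Type} [NormedAddCommGroup F] [NormedSpace ℝ F]
    (A : Ell1 →L[ℝ] F) (hA : Function.Injective A) :
    ∃ T : Ell1Prod →L[ℝ] F, (∀ a, T a ∈ LinearMap.range A.toLinearMap) ∧ Function.Injective T ∧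
      ‖T‖ = 1 ∧ ∀ m : ℕ, {y : F | y ∈ LinearMap.range A.toLinearMap ∧ ‖y‖ = 1} ⊆
        closure (Set.range fun n : ℕ =>
          ‖T (lp.single 1 (n, m) 1)‖⁻¹ • T (lp.single 1 (n, m) 1)) := by
  set T₀ := A.comp dirOp with hT₀
  have hinj : Function.Injective T₀ := hA.comp dirOp_injective
  have hne : T₀ ≠ 0 := fun h0 => by
    have h1 : (lp.single 1 (0, 0) (1 : ℝ) : Ell1Prod) = 0 :=
      hinj (by rw [h0, zero_apply, zero_apply])
    have h2 := congrArg norm h1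
    rw [lp.norm_single (by simp)] at h2
    simp at h2
  have hpos : 0 < ‖T₀‖⁻¹ := inv_pos.mpr (norm_pos_iff.mpr hne)
  refine ⟨‖T₀‖⁻¹ • T₀, fun a => ?_, fun a b hab => ?_, ?_, fun m => ?_⟩
  · exact Submodule.smul_mem _ _ ⟨dirOp a, rfl⟩
  · exact hinj (smul_right_injective F hpos.ne' hab)
  · rw [norm_smul, norm_inv, norm_norm, inv_mul_cancel₀ (norm_ne_zero_iff.mpr hne)]
  · rintro _ ⟨⟨h, rfl⟩, hy⟩
    have hh : h ≠ 0 := fun h0 => by simp [h0] at hy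
    have h1 := normalize_apply_mem_closure A hA m hh
    rw [NormedSpace.normalize_eq_self_of_norm_eq_one (show ‖A h‖ = 1 from hy)] at h1
    have h3 : (fun n : ℕ => ‖(‖T₀‖⁻¹ • T₀) (lp.single 1 (n, m) 1)‖⁻¹ •
        (‖T₀‖⁻¹ • T₀) (lp.single 1 (n, m) 1)) =
        fun n => NormedSpace.normalize (A (dirOp (lp.single 1 (n, m) 1))) :=
      funext fun n => NormedSpace.normalize_smul_of_pos hpos (T₀ (lp.single 1 (n, m) 1))
    rw [h3]
    exact h1

/-! ### Existence of the choices. -/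

theorem nonempty_choices : Nonempty Choices := by
  obtain ⟨T, hTm, hTi, hTn, hTd⟩ :=
    exists_dense_directions (rangeOp smoothNorm) (rangeOp_injective smoothNorm)
  exact ⟨{
    q := smoothNorm
    smooth := isSmoothSpace_smoothNorm
    na_eq := isNormAttaining_smoothNorm_iff
    Y := LinearMap.range (rangeOp smoothNorm).toLinearMap
    opRange := ⟨Ell1, inferInstance, inferInstance, inferInstance, rangeOp smoothNorm,
      not_finiteDimensional_ell1, rangeOp_injective smoothNorm, rfl⟩
    separable := by
      have h := TopologicalSpace.isSeparable_range (rangeOp smoothNorm).continuous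
      exact h
    dense := dense_range_rangeOp smoothNorm
    na_inter := by
      refine Set.Subset.antisymm ?_ ?_
      · rintro _ ⟨hf, a, rfl⟩
        have ha := eq_zero_of_isNormAttaining_rangeOp smoothNorm a
          ((isNormAttaining_smoothNorm_iff _).mp hf)
        rw [Set.mem_singleton_iff, ha]
        exact map_zero (rangeOp smoothNorm)
      · rintro _ rfl
        have : Nontrivial smoothNorm.Space := inferInstanceAs (Nontrivial C₀(ℕ, ℝ))
        exact ⟨isNormAttaining_zero _, Submodule.zero_mem _⟩
    T := T
    T_mem := hTm
    T_inj := hTi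
    T_norm := hTn
    T_dense := hTd }⟩

end

theorem mainTheorem2 :
    Nonempty Choices ∧
      ∀ D : Choices,
        StrictConvexSpace ℝ (StrongDual ℝ (StrongDual ℝ D.X)) ∧
          IsSmoothSpace (StrongDual ℝ D.X) ∧
            StrictConvexSpace ℝ D.X :=
  ⟨nonempty_choices, geometry_of_choices⟩
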